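/- Let $a,b,\alpha>0$ be real numbers. The series \[ F_{a,b}^{(\alpha)}(z)=\sum_{n=0}^\infty \frac{z^n}{\Gamma(an+b)^\alpha} \] converges absolutely for every $z\in\mathbb{C}$. Let moreover $\varepsilon>0$ be arbitrary. Then, as $z\to\infty$ in the sector \[ |\arg z|\le \begin{cases} \tfrac12 a\alpha\pi-\varepsilon, & 0<a\alpha<2,\\ (2-\tfrac12 a\alpha)\pi-\varepsilon, & 2\le a\alpha<4,\\ 0, & a\alpha\ge 4, \end{cases} \] one has \[ F_{a,b}^{(\alpha)}(z)\sim \frac{1}{a\sqrt{\alpha}}\,(2\pi)^{\frac{1-\alpha}{2}}\, z^{\frac{\alpha-2b\alpha+1}{2a\alpha}}\exp\!\left(\alpha z^{1/(a\alpha)}\right), \] where $\arg z\in(-\pi,\pi]$ and the powers of $z$ are the principal ones. Here $\sim$ means that the quotient of the two sides tends to $1$ as $|z|\to\infty$, uniformly in the sector. -/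

import Mathlib

open Filter Asymptotics

/-- The `n`-th term `z ^ n / Γ(a n + b) ^ α` of the generalized Mittag-Leffler series. For
`a, b, α > 0` the number `Γ(a n + b)` is positive, and `Γ(a n + b) ^ α` is its real power. -/
noncomputable def mlTerm (a b α : ℝ) (z : ℂ) (n : ℕ) : ℂ :=
  z ^ n / ((Real.Gamma (a * (n : ℝ) + b) ^ α : ℝ) : ℂ)

/-- The generalized Mittag-Leffler function `F_{a,b}^{(α)}(z) = ∑ z ^ n / Γ(a n + b) ^ α`. -/
noncomputable def mlF (a b α : ℝ) (z : ℂ) : ℂ :=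
  ∑' n : ℕ, mlTerm a b α z n

/-- The bound on `|arg z|`. -/
noncomputable def argBound (a α ε : ℝ) : ℝ :=
  if a * α < 2 then a * α / 2 * Real.pi - ε
  else if a * α < 4 then (2 - a * α / 2) * Real.pi - ε
  else 0

/-- The sector of all `z` with `|arg z|` at most the bound; `Complex.arg` takes its values in
`(-π, π]`. -/
def mlSector (a α ε : ℝ) : Set ℂ :=
  {z : ℂ | |Complex.arg z| ≤ argBound a α ε}

/-- The asymptotic main term
`(1 / (a √α)) (2π) ^ ((1 - α) / 2) z ^ ((α - 2 b α + 1) / (2 a α)) exp (α z ^ (1 / (a α)))`,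
with principal powers of `z`. -/
noncomputable def mlMain (a b α : ℝ) (z : ℂ) : ℂ :=
  ((1 / (a * Real.sqrt α) * (2 * Real.pi) ^ ((1 - α) / 2) : ℝ) : ℂ)
    * z ^ (((α - 2 * b * α + 1) / (2 * a * α) : ℝ) : ℂ)
    * Complex.exp ((α : ℂ) * z ^ ((1 / (a * α) : ℝ) : ℂ))

/-! The terms of the series are the values at s = n of f(s) = Γ(as+b)^(-α) z^s. Gudermann's series
supplies a logarithm of Γ that is holomorphic on Re u > 0 and real on the positive axis
(`exp_logGamma`, `logGamma_ofReal`), so f is holomorphic for Re s > -b/a and agrees exactly with the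
real powers in the series.

Put w = z^(1/(aα)). By Stirling's formula, on the ray s = wx/a the function f is e^(αw)
w^(-α(b-1/2)) times a slowly varying factor times exp(-αw(x log x - x + 1)). The phase is minimal at
x = 1, and Laplace's method with Gaussian width |w|^(-1/2) shows that (w/a)∫ f(wx/a) dx is
asymptotic to the main term (`tendsto_integral_saddleIntegrand`). If |arg w| stays below π/2 by a
fixed amount, which is the bound |arg z| ≤ aαπ/2 - ε, this integral equals ∫ f over the positive
half-line by rotation (`integral_Ioi_eq_integral_ray`).

It remains to pass from the sum to the integral. For aα < 4 Poisson summation is used: each nonzero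
Fourier coefficient is rotated to the half of the imaginary axis on which exp(-2πiks) decays. There
f grows at most like exp((aαπ/2 + |arg z|)|y|), up to an arbitrarily small loss in the exponent, and
the kernel decays like exp(-2π|k||y|). This is the origin of the second bound |arg z| ≤ (2 - aα/2)π
- ε. The resulting error is O(1 + log|z|) (`exists_norm_mlF_sub_integral_le`), negligible against a
main term exponentially large in |w|.

For aα ≥ 4 only positive z occur, and the sum is the integral of f(⌊y⌋). In the variable x the floor
moves the point by at most a/|w|, far less than the Gaussian width, and the saddle point theorem is
stated so as to tolerate such a perturbation.

Uniformity holds because all limits are taken along `cobounded ℂ ⊓ 𝓟 T` for a sector T, and the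
angle enters only through a fixed κ > 0 with κ|w| ≤ Re w. -/

namespace MittagLeffler

open Complex Topology Bornology

/-! ### Stirling's formula for the complex Gamma function in the right half-plane -/

/-- The terms of Gudermann's series for the remainder in Stirling's formula. -/
noncomputable def stirlingTerm (u : ℂ) : ℂ := (u + 1 / 2) * (log (u + 1) - log u) - 1

/-- The remainder in Stirling's formula. -/
noncomputable def stirlingRem (u : ℂ) : ℂ := ∑' n : ℕ, stirlingTerm (u + n)

/-- The holomorphic logarithm of the Gamma function in the right half-plane. -/
noncomputable def logGamma (u : ℂ) : ℂ :=
  (u - 1 / 2) * log u - u + (Real.log (2 * Real.pi) / 2 : ℝ) + stirlingRem u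

lemma norm_le_norm_add_ofReal {u : ℂ} (hu : 0 ≤ u.re) {t : ℝ} (ht : 0 ≤ t) :
    ‖u‖ ≤ ‖u + t‖ := by
  rw [← sq_le_sq₀ (norm_nonneg _) (norm_nonneg _), Complex.sq_norm, Complex.sq_norm,
    normSq_apply, normSq_apply]
  simp only [add_re, ofReal_re, add_im, ofReal_im, add_zero]
  nlinarith [mul_nonneg hu ht, sq_nonneg t]

lemma le_norm_add_ofReal {u : ℂ} (hu : 0 ≤ u.re) (t : ℝ) : t ≤ ‖u + t‖ := by
  refine le_trans ?_ (re_le_norm _)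
  simpa using hu

lemma add_ofReal_mem_slitPlane {u : ℂ} (hu : 0 ≤ u.re) {t : ℝ} (ht : 0 < t) :
    u + t ∈ slitPlane := by
  left
  simp only [add_re, ofReal_re]
  linarith

/-- Integration by parts gives the term as the integral of (t(1-t)/2)/(u+t)² over [0,1], and
t(1-t)/2 ≤ 1/8. The function `f` below is the corresponding primitive. -/
lemma norm_stirlingTerm_le {u : ℂ} (hu : 0 < u.re) : ‖stirlingTerm u‖ ≤ 1 / (8 * ‖u‖ ^ 2) := by
  have hu0 : u ≠ 0 := by rintro rfl; simp at hu
  have hpos : 0 < ‖u‖ := norm_pos_iff.2 hu0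
  have key : ∀ t ∈ Set.Icc (0 : ℝ) 1, u + t ∈ slitPlane := fun t ht => by
    left; simp only [add_re, ofReal_re]; linarith [ht.1]
  have := norm_image_sub_le_of_norm_deriv_le_segment_01'
    (f := fun t : ℝ => (u + 1 / 2) * log (u + t) - t - (t * (1 - t) / 2) / (u + t))
    (f' := fun t : ℝ => (t * (1 - t) / 2) / (u + t) ^ 2) (C := 1 / (8 * ‖u‖ ^ 2))
    (fun t ht => by
      have hs := key t ht
      have hne : u + t ≠ 0 := slitPlane_ne_zero hs
      have h1 : HasDerivAt (fun t : ℝ => (t : ℂ)) 1 t := ofRealCLM.hasDerivAt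
      have h2 : HasDerivAt (fun t : ℝ => u + (t : ℂ)) 1 t := h1.const_add u
      have h3 := h2.clog_real hs
      have h4 := (((h1.mul ((h1.const_sub 1))).div_const 2).div h2 hne)
      have h5 := ((h3.const_mul (u + 1 / 2)).sub h1).sub h4
      refine (h5.congr_deriv ?_).hasDerivWithinAt
      simp only [Pi.mul_apply]
      field_simp
      ring)
    (fun t ht => by
      have h1 := norm_le_norm_add_ofReal hu.le ht.1
      rw [norm_div, norm_pow]
      have h2 : ‖(t * (1 - t) / 2 : ℂ)‖ ≤ 1 / 8 := by
        have : (t * (1 - t) / 2 : ℂ) = ((t * (1 - t) / 2 : ℝ) : ℂ) := by push_cast; ring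
        rw [this, norm_real, Real.norm_eq_abs, abs_of_nonneg]
        · nlinarith [sq_nonneg (t - 1 / 2)]
        · have := ht.1; have := ht.2; have : 0 ≤ 1 - t := by linarith
          positivity
      calc _ ≤ (1 / 8) / ‖u‖ ^ 2 := by gcongr
        _ = _ := by field_simp)
  refine le_trans (le_of_eq ?_) this
  congr 1
  simp [stirlingTerm]
  ring

lemma re_add_natCast_pos {u : ℂ} (hu : 0 < u.re) (n : ℕ) : 0 < (u + n).re := by
  rw [add_re, natCast_re]; positivity

lemma norm_stirlingTerm_add_nat_le {η : ℝ} (hη : 0 < η) {u : ℂ} (hu : η ≤ u.re) (n : ℕ) :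
    ‖stirlingTerm (u + n)‖ ≤ 1 / (8 * (η + n) ^ 2) := by
  refine (norm_stirlingTerm_le (re_add_natCast_pos (hη.trans_le hu) n)).trans ?_
  have : η + n ≤ ‖u + n‖ := by
    refine le_trans ?_ (re_le_norm _); simpa using hu
  gcongr

lemma summable_stirling_bound {η : ℝ} (hη : 0 < η) :
    Summable fun n : ℕ => 1 / (8 * (η + n) ^ 2) := by
  have h : Summable fun n : ℕ => 1 / (8 : ℝ) * (1 / |(n : ℝ) + η| ^ (2 : ℝ)) :=
    ((Real.summable_one_div_nat_add_rpow η 2).2 one_lt_two).mul_left _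
  refine h.congr fun n => ?_
  rw [abs_of_pos (by positivity)]
  norm_cast
  field_simp
  rw [add_comm]

lemma differentiableOn_stirlingRem : DifferentiableOn ℂ stirlingRem {u | 0 < u.re} := by
  intro u hu
  have hu : 0 < u.re := hu
  have hη : 0 < u.re / 2 := by positivity
  have hU : IsOpen {v : ℂ | u.re / 2 < v.re} := isOpen_lt continuous_const continuous_re
  have := differentiableOn_tsum_of_summable_norm (F := fun (n : ℕ) v => stirlingTerm (v + n))
    (U := {v : ℂ | u.re / 2 < v.re}) (summable_stirling_bound hη) (fun n => by
      intro v hv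
      have hv : u.re / 2 < v.re := hv
      have hp := re_add_natCast_pos (hη.trans hv) n
      have h1 : v + n ∈ slitPlane := Or.inl hp
      have h2 : v + n + 1 ∈ slitPlane := by left; rw [add_re, one_re]; positivity
      unfold stirlingTerm
      exact (((differentiableAt_id.add_const (n : ℂ)).add_const (1 / 2 : ℂ)).mul
        ((((differentiableAt_id.add_const (n : ℂ)).add_const (1 : ℂ)).clog h2).sub
          ((differentiableAt_id.add_const (n : ℂ)).clog h1))).sub_const _
        |>.differentiableWithinAt)
    hU (fun n _ hv => norm_stirlingTerm_add_nat_le hη (le_of_lt hv) n)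
  exact (this.differentiableAt (hU.mem_nhds (by simpa using hu))).differentiableWithinAt

lemma summable_stirlingTerm {u : ℂ} (hu : 0 < u.re) :
    Summable fun n : ℕ => stirlingTerm (u + n) :=
  Summable.of_norm_bounded (summable_stirling_bound hu)
    (fun n => norm_stirlingTerm_add_nat_le hu le_rfl n)

lemma exists_norm_stirlingRem_le {η : ℝ} (hη : 0 < η) :
    ∃ C, ∀ u : ℂ, η ≤ u.re → ‖stirlingRem u‖ ≤ C :=
  ⟨_, fun _ hu => tsum_of_norm_bounded (summable_stirling_bound hη).hasSum
    (fun n => norm_stirlingTerm_add_nat_le hη hu n)⟩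

/-- Dominated convergence in n: each term is O(1/|u|²), and the half-plane Re u ≥ η has a summable
majorant independent of u. -/
lemma tendsto_stirlingRem {η : ℝ} (hη : 0 < η) :
    Tendsto stirlingRem (cobounded ℂ ⊓ 𝓟 {u | η ≤ u.re}) (𝓝 0) := by
  have h := tendsto_tsum_of_dominated_convergence (𝓕 := cobounded ℂ ⊓ 𝓟 {u | η ≤ u.re})
    (f := fun u (n : ℕ) => stirlingTerm (u + n)) (g := fun _ => 0)
    (summable_stirling_bound hη) (fun n => by
      refine squeeze_zero_norm' (a := fun u : ℂ => 1 / (8 * ‖u‖ ^ 2)) ?_ ?_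
      · filter_upwards [mem_inf_of_right (mem_principal_self _), mem_inf_of_left
          (eventually_cobounded_le_norm 1)] with u hu h1
        have hu : η ≤ u.re := hu
        refine (norm_stirlingTerm_le (re_add_natCast_pos (hη.trans_le hu) n)).trans ?_
        have h1 : 1 ≤ ‖u‖ := h1
        have := norm_le_norm_add_ofReal (hη.le.trans hu) (Nat.cast_nonneg n)
        rw [ofReal_natCast] at this
        gcongr
      · refine Tendsto.mono_left ?_ inf_le_left
        have : Tendsto (fun u : ℂ => 8 * ‖u‖ ^ 2) (cobounded ℂ) atTop :=
          Tendsto.const_mul_atTop (by norm_num)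
            ((tendsto_pow_atTop two_ne_zero).comp tendsto_norm_cobounded_atTop)
        exact this.inv_tendsto_atTop.congr fun u => (one_div _).symm)
    (by
      filter_upwards [mem_inf_of_right (mem_principal_self _)] with u hu n
      exact norm_stirlingTerm_add_nat_le hη hu n)
  rw [tsum_zero] at h
  exact h

lemma log_mul_of_re_pos {x y : ℂ} (hx : 0 < x.re) (hy : 0 < y.re) :
    log (x * y) = log x + log y := by
  have hx0 : x ≠ 0 := by rintro rfl; simp at hx
  have hy0 : y ≠ 0 := by rintro rfl; simp at hy
  rw [log_mul_eq_add_log_iff hx0 hy0]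
  have h1 := abs_lt.1 (abs_arg_lt_pi_div_two_iff.2 (Or.inl hx))
  have h2 := abs_lt.1 (abs_arg_lt_pi_div_two_iff.2 (Or.inl hy))
  constructor <;> linarith [h1.1, h1.2, h2.1, h2.2]

/-- `(u + d) (log (u + v) - log u) → v` as `u → ∞` in the right half-plane. -/
lemma tendsto_mul_log_add_sub_log (v d : ℂ) :
    Tendsto (fun u => (u + d) * (log (u + v) - log u)) (cobounded ℂ ⊓ 𝓟 {u | 0 < u.re})
      (𝓝 v) := by
  set l := cobounded ℂ ⊓ 𝓟 {u : ℂ | 0 < u.re}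
  have hinv : Tendsto (fun u : ℂ => u⁻¹) l (𝓝 0) :=
    (tendsto_inv₀_cobounded (α := ℂ)).mono_left inf_le_left
  have hv : Tendsto (fun u : ℂ => v * u⁻¹) l (𝓝 0) := by simpa using hinv.const_mul v
  have hne : ∀ᶠ u : ℂ in l, u ≠ 0 :=
    mem_inf_of_left (eventually_ne_cobounded 0)
  -- `dslope` is log(1+t)/t with the removable value 1 at t = 0, so v = 0 needs no separate
  -- treatment.
  have hslope : Tendsto (fun t : ℂ => dslope (fun t => log (1 + t)) 0 t) (𝓝 0) (𝓝 1) := by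
    have hd : HasDerivAt (fun t : ℂ => log (1 + t)) 1 0 := by
      have := ((hasDerivAt_id (0 : ℂ)).const_add 1).clog (by simp)
      simpa using this
    have hc := continuousAt_dslope_same.2 hd.differentiableAt
    have := hc.tendsto
    rwa [dslope_same, hd.deriv] at this
  have h1 := (hslope.comp hv).const_mul v
  have h2 : Tendsto (fun u : ℂ => 1 + d * u⁻¹) l (𝓝 1) := by
    simpa using (hinv.const_mul d).const_add 1
  have h3 := h2.mul h1
  simp only [mul_one, one_mul] at h3
  refine h3.congr' ?_
  have hsmall : ∀ᶠ u : ℂ in l, ‖v * u⁻¹‖ < 1 := by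
    have := hv.norm
    rw [norm_zero] at this
    exact this.eventually_lt_const one_pos
  filter_upwards [hne, hsmall, mem_inf_of_right (mem_principal_self _)] with u hu hs hre
  have hre' : 0 < (1 + v * u⁻¹).re := by
    have := (abs_le.1 (abs_re_le_norm (v * u⁻¹))).1
    rw [add_re, one_re]; linarith
  have e1 : u + v = u * (1 + v * u⁻¹) := by field_simp
  rw [e1, log_mul_of_re_pos hre hre', add_sub_cancel_left]
  have e2 : v * u⁻¹ * dslope (fun t => log (1 + t)) 0 (v * u⁻¹) = log (1 + v * u⁻¹) := by
    have := sub_smul_dslope (fun t : ℂ => log (1 + t)) 0 (v * u⁻¹)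
    simpa using this
  rw [← e2]
  simp only [Function.comp_apply]
  field_simp

/-- Summation by parts: the weights u+n+1/2 increase by one, leaving a boundary term and the plain
sum of logarithms. -/
lemma sum_stirlingTerm (u : ℂ) (N : ℕ) :
    (u - 1 / 2) * log u - u + ∑ n ∈ Finset.range N, stirlingTerm (u + n) =
      (u + N - 1 / 2) * log (u + N) - N - u - ∑ n ∈ Finset.range N, log (u + n) := by
  induction N with
  | zero => simp
  | succ N ih =>
    rw [Finset.sum_range_succ, Finset.sum_range_succ, ← add_assoc, ih, stirlingTerm]
    push_cast
    ring_nf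

lemma tendsto_sqrt_two_mul_stirlingSeq :
    Tendsto (fun n : ℕ => ((√2 * Stirling.stirlingSeq n : ℝ) : ℂ)) atTop
      (𝓝 ((√(2 * Real.pi) : ℝ) : ℂ)) := by
  have := (Stirling.tendsto_stirlingSeq_sqrt_pi).const_mul √2
  rw [← Real.sqrt_mul (by norm_num)] at this
  exact (continuous_ofReal.tendsto _).comp this

/-- The range M + 1 matches the factors u, …, u+M in the denominator of `GammaSeq u M`. Its
numerator M! is expressed through `stirlingSeq M`, which later contributes √(2π). -/
lemma exp_sum_stirlingTerm {u : ℂ} (hu : 0 < u.re) {M : ℕ} (hM : M ≠ 0) :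
    exp ((u - 1 / 2) * log u - u + ∑ n ∈ Finset.range (M + 1), stirlingTerm (u + n)) =
      GammaSeq u M * (exp ((M + (u + 1 / 2)) * (log (M + (u + 1)) - log M) - (u + 1)) /
        ((√2 * Stirling.stirlingSeq M : ℝ) : ℂ)) := by
  have hM' : (0 : ℝ) < M := by positivity
  have hMc : (M : ℂ) ≠ 0 := by exact_mod_cast hM
  have hprod : exp (∑ n ∈ Finset.range (M + 1), log (u + n)) =
      ∏ n ∈ Finset.range (M + 1), (u + n) := by
    rw [exp_sum]
    refine Finset.prod_congr rfl fun n _ => exp_log ?_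
    intro h
    have := congrArg re h
    simp at this
    have : (0 : ℝ) ≤ n := by positivity
    linarith
  have hprod0 : (∏ n ∈ Finset.range (M + 1), (u + n)) ≠ 0 := by
    rw [← hprod]; exact exp_ne_zero _
  have hfac : (M.factorial : ℂ) = ((√2 * Stirling.stirlingSeq M : ℝ) : ℂ) *
      exp (log M / 2 + M * log M - M) := by
    have hr : (M.factorial : ℝ) = √2 * Stirling.stirlingSeq M *
        Real.exp (Real.log M / 2 + M * Real.log M - M) := by
      have e1 : Real.exp (Real.log M / 2 + M * Real.log M - M) = √M * (M / Real.exp 1) ^ M := by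
        rw [Real.exp_sub, Real.exp_add, Real.sqrt_eq_rpow, Real.rpow_def_of_pos hM', div_pow,
          ← Real.exp_nat_mul, mul_one, mul_div_assoc]
        congr 1
        · congr 1; ring
        · congr 1
          rw [Real.exp_nat_mul, Real.exp_log hM']
      rw [e1, Stirling.stirlingSeq, Real.sqrt_mul (by norm_num)]
      have : 0 < √(M : ℝ) := Real.sqrt_pos.2 hM'
      field_simp
    have := congrArg ((↑) : ℝ → ℂ) hr
    push_cast [ofReal_log hM'.le] at this ⊢
    simpa using this
  have hs0 : ((√2 * Stirling.stirlingSeq M : ℝ) : ℂ) ≠ 0 := by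
    intro h
    rw [h, zero_mul] at hfac
    exact (Nat.cast_ne_zero.2 M.factorial_ne_zero) hfac
  rw [sum_stirlingTerm, exp_sub, hprod, GammaSeq, hfac, cpow_def_of_ne_zero hMc]
  generalize ((√2 * Stirling.stirlingSeq M : ℝ) : ℂ) = S at hs0 ⊢
  rw [div_eq_iff hprod0, div_mul_eq_mul_div, div_mul_cancel₀ _ hprod0]
  rw [show ∀ A B D : ℂ, A * (S * B) * (D / S) = A * B * D by intros; field_simp,
    ← exp_add, ← exp_add]
  congr 1
  rw [show u + (M + 1 : ℕ) = M + (u + 1) by push_cast; ring]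
  push_cast
  ring

/-- `logGamma` is a logarithm of the Gamma function in the right half-plane. -/
lemma exp_logGamma {u : ℂ} (hu : 0 < u.re) : exp (logGamma u) = Gamma u := by
  have hsum : Tendsto (fun M : ℕ => ∑ n ∈ Finset.range (M + 1), stirlingTerm (u + n)) atTop
      (𝓝 (stirlingRem u)) :=
    ((summable_stirlingTerm hu).hasSum.tendsto_sum_nat).comp (tendsto_add_atTop_nat 1)
  have hl : Tendsto (fun M : ℕ => exp ((u - 1 / 2) * log u - u +
      ∑ n ∈ Finset.range (M + 1), stirlingTerm (u + n))) atTop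
      (𝓝 (exp ((u - 1 / 2) * log u - u + stirlingRem u))) :=
    (continuous_exp.tendsto _).comp (hsum.const_add _)
  have hnat : Tendsto (fun M : ℕ => (M : ℂ)) atTop (cobounded ℂ ⊓ 𝓟 {u | 0 < u.re}) := by
    refine tendsto_inf.2 ⟨?_, tendsto_principal.2 ?_⟩
    · rw [← tendsto_norm_atTop_iff_cobounded]
      simpa using tendsto_natCast_atTop_atTop (R := ℝ)
    · filter_upwards [eventually_gt_atTop 0] with M hM
      simpa using hM
  -- The exponent (M+u+1/2)(log(M+u+1) - log M) tends to u+1, so the correction factor tends to 1.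
  have h1 := (continuous_exp.tendsto _).comp
    (((tendsto_mul_log_add_sub_log (u + 1) (u + 1 / 2)).comp hnat).sub_const (u + 1))
  rw [sub_self, exp_zero] at h1
  have hpi : ((√(2 * Real.pi) : ℝ) : ℂ) ≠ 0 := by
    rw [ofReal_ne_zero]; positivity
  have hr := (GammaSeq_tendsto_Gamma u).mul (h1.div tendsto_sqrt_two_mul_stirlingSeq hpi)
  have heq := tendsto_nhds_unique hl (hr.congr' (by
    filter_upwards [eventually_ne_atTop 0] with M hM
    exact (exp_sum_stirlingTerm hu hM).symm))
  have : logGamma u = ((u - 1 / 2) * log u - u + stirlingRem u) +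
      ((Real.log (2 * Real.pi) / 2 : ℝ) : ℂ) := by
    rw [logGamma]; ring
  rw [this, exp_add, heq, ← ofReal_exp]
  have : Real.exp (Real.log (2 * Real.pi) / 2) = √(2 * Real.pi) := by
    rw [Real.sqrt_eq_rpow, Real.rpow_def_of_pos (by positivity)]
    congr 1; ring
  rw [this]
  field_simp

/-- Gudermann's series is real for real x, so injectivity of the real exponential excludes an
additive multiple of 2πi. -/
lemma logGamma_ofReal {x : ℝ} (hx : 0 < x) : logGamma x = (Real.log (Real.Gamma x) : ℝ) := by
  have hterm : ∀ y : ℝ, 0 < y → stirlingTerm y =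
      ((y + 1 / 2) * (Real.log (y + 1) - Real.log y) - 1 : ℝ) := fun y hy => by
    rw [stirlingTerm]
    push_cast
    rw [ofReal_log hy.le, ofReal_log (by positivity)]
    push_cast
    ring
  have hrem : stirlingRem x = (∑' n : ℕ,
      ((x + n + 1 / 2) * (Real.log (x + n + 1) - Real.log (x + n)) - 1) : ℝ) := by
    rw [stirlingRem, ofReal_tsum]
    refine tsum_congr fun n => ?_
    rw [← hterm _ (by positivity)]
    push_cast
    rfl
  obtain ⟨r, hr⟩ : ∃ r : ℝ, logGamma x = r := by
    refine ⟨(x - 1 / 2) * Real.log x - x + Real.log (2 * Real.pi) / 2 +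
      ∑' n : ℕ, ((x + n + 1 / 2) * (Real.log (x + n + 1) - Real.log (x + n)) - 1), ?_⟩
    rw [logGamma, hrem]
    push_cast
    rw [ofReal_log hx.le]
  have h := exp_logGamma (u := x) (by simpa using hx)
  rw [hr, Gamma_ofReal, ← ofReal_exp] at h
  rw [hr, ← ofReal_injective h, Real.log_exp]

lemma differentiableOn_logGamma : DifferentiableOn ℂ logGamma {u | 0 < u.re} := by
  intro u hu
  have hs : u ∈ slitPlane := Or.inl hu
  unfold logGamma
  exact ((((differentiableAt_id.sub_const _).mul (differentiableAt_id.clog hs)).sub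
    differentiableAt_id).add_const _).differentiableWithinAt.add (differentiableOn_stirlingRem u hu)

/-! ### The coefficient function and its growth -/

/-- The quotient of `Γ(u + b) ^ (-α)` by `exp (-α (u log u - u))`. -/
noncomputable def gammaQuot (b α : ℝ) (u : ℂ) : ℂ :=
  exp (-α * (logGamma (u + b) - u * log u + u))

/-- The holomorphic function `Γ(a s + b) ^ (-α)`. -/
noncomputable def mlCoeff (a b α : ℝ) (s : ℂ) : ℂ := exp (-α * logGamma (a * s + b))

/-- The holomorphic function of `s` interpolating the terms of the Mittag-Leffler series. -/
noncomputable def mlInterp (a b α : ℝ) (z s : ℂ) : ℂ := mlCoeff a b α s * exp (s * log z)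

lemma rpow_le_rpow_abs {A x : ℝ} (hA : 0 < A) (h1 : A⁻¹ ≤ x) (h2 : x ≤ A) (p : ℝ) :
    x ^ p ≤ A ^ |p| := by
  have hx : 0 < x := (inv_pos.2 hA).trans_le h1
  rw [Real.rpow_def_of_pos hx, Real.rpow_def_of_pos hA, Real.exp_le_exp]
  have h3 := Real.log_le_log (inv_pos.2 hA) h1
  have h4 := Real.log_le_log hx h2
  rw [Real.log_inv] at h3
  calc Real.log x * p ≤ |Real.log x * p| := le_abs_self _
    _ = |Real.log x| * |p| := abs_mul _ _
    _ ≤ Real.log A * |p| := by gcongr; exact abs_le.2 ⟨h3, h4⟩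

lemma norm_mul_log_add_sub_log_le {b : ℝ} (hb : 0 < b) {u : ℂ} (hu : 0 ≤ u.re) :
    ‖u * (log (u + b) - log u)‖ ≤ b := by
  rcases eq_or_ne u 0 with rfl | hu0
  · simpa using hb.le
  have hpos : 0 < ‖u‖ := norm_pos_iff.2 hu0
  have key : ∀ t ∈ Set.Icc (0 : ℝ) b, u + t ∈ slitPlane := fun t ht => by
    -- Only t = 0 is delicate: u may lie on the imaginary axis, where u ≠ 0 keeps it off the cut.
    rcases ht.1.eq_or_lt with rfl | h
    · rw [ofReal_zero, add_zero, mem_slitPlane_iff]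
      rcases hu.eq_or_lt with h | h
      · right; intro hi; exact hu0 (Complex.ext h.symm hi)
      · exact Or.inl h
    · exact add_ofReal_mem_slitPlane hu h
  have := norm_image_sub_le_of_norm_deriv_le_segment'
    (f := fun t : ℝ => log (u + t)) (f' := fun t : ℝ => 1 / (u + t)) (C := 1 / ‖u‖)
    (fun t ht => by
      have h1 : HasDerivAt (fun t : ℝ => (t : ℂ)) 1 t := ofRealCLM.hasDerivAt
      exact ((h1.const_add u).clog_real (key t ht)).hasDerivWithinAt)
    (fun t ht => by
      have h1 := norm_le_norm_add_ofReal hu ht.1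
      rw [norm_div, norm_one]
      gcongr) b (Set.right_mem_Icc.2 hb.le)
  rw [norm_mul]
  simp only [ofReal_zero, add_zero, sub_zero] at this
  calc _ ≤ ‖u‖ * (1 / ‖u‖ * b) := by gcongr
    _ = b := by field_simp

lemma logGamma_add_sub (b : ℝ) (u : ℂ) :
    logGamma (u + b) - u * log u + u = u * (log (u + b) - log u) + (b - 1 / 2) * log (u + b)
      - b + (Real.log (2 * Real.pi) / 2 : ℝ) + stirlingRem (u + b) := by
  rw [logGamma]; ring

/-- The estimate `gammaQuot b α u = O((1 + |u|) ^ (-α (b - 1/2)))` in the closed right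
half-plane. -/
lemma exists_norm_gammaQuot_le {b α : ℝ} (hb : 0 < b) (hα : 0 < α) :
    ∃ C, 0 < C ∧ ∀ u : ℂ, 0 ≤ u.re →
      ‖gammaQuot b α u‖ ≤ C * (1 + ‖u‖) ^ (-(α * (b - 1 / 2))) := by
  obtain ⟨K, hK⟩ := exists_norm_stirlingRem_le hb
  set k := Real.log (2 * Real.pi) / 2 with hk
  -- Both |u+b|/(1+|u|) and its inverse are at most A, because |u+b| ≥ |u|, |u+b| ≥ b and |u+b| ≤
  -- |u|+b. The power can then be compared whatever the sign of p.
  set A := 1 + b + b⁻¹ with hA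
  set p := -(α * (b - 1 / 2)) with hp
  have hA0 : 0 < A := by positivity
  refine ⟨Real.exp (α * (b + b + |k| + K)) * A ^ |p|, by positivity, fun u hu => ?_⟩
  have hub : 0 < ‖u + b‖ := norm_pos_iff.2 (slitPlane_ne_zero (add_ofReal_mem_slitPlane hu hb))
  have h1 := (abs_le.1 ((abs_re_le_norm _).trans (norm_mul_log_add_sub_log_le hb hu))).1
  have h2 := (abs_le.1 ((abs_re_le_norm _).trans (hK (u + b) (by simpa using hu)))).1
  have h3 := (abs_le.1 (le_refl |k|)).1
  have hre : (-α * (logGamma (u + b) - u * log u + u)).re ≤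
      α * (b + b + |k| + K) + Real.log ‖u + b‖ * p := by
    rw [logGamma_add_sub, ← hk, ← ofReal_neg, re_ofReal_mul]
    have : ((b - 1 / 2 : ℂ) * log (u + b)).re = (b - 1 / 2) * Real.log ‖u + b‖ := by
      rw [show (b - 1 / 2 : ℂ) = ((b - 1 / 2 : ℝ) : ℂ) by push_cast; ring, re_ofReal_mul, log_re]
    rw [add_re, add_re, sub_re, add_re, this, ofReal_re, ofReal_re, hp]
    nlinarith
  have hratio : (‖u + b‖ / (1 + ‖u‖)) ^ p ≤ A ^ |p| := by
    refine rpow_le_rpow_abs hA0 ?_ ?_ p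
    · rw [inv_eq_one_div, div_le_div_iff₀ hA0 (by positivity), hA]
      have e1 := norm_le_norm_add_ofReal hu hb.le
      have e2 := le_norm_add_ofReal hu b
      have e3 : 1 ≤ ‖u + b‖ * b⁻¹ := by
        rw [← div_eq_mul_inv, one_le_div hb]; exact e2
      nlinarith [mul_nonneg hub.le hb.le]
    · rw [div_le_iff₀ (by positivity)]
      have e1 : ‖u + b‖ ≤ ‖u‖ + b := (norm_add_le _ _).trans (by simp [abs_of_pos hb])
      have : 0 < b⁻¹ := by positivity
      have e4 : 0 ≤ b * ‖u‖ := by positivity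
      have e5 : 0 ≤ b⁻¹ * ‖u‖ := by positivity
      rw [hA]; nlinarith
  rw [Real.div_rpow hub.le (by positivity), div_le_iff₀ (by positivity)] at hratio
  rw [gammaQuot, norm_exp]
  calc _ ≤ Real.exp (α * (b + b + |k| + K) + Real.log ‖u + b‖ * p) := Real.exp_le_exp.2 hre
    _ = Real.exp (α * (b + b + |k| + K)) * ‖u + b‖ ^ p := by
      rw [Real.exp_add, Real.rpow_def_of_pos hub]
    _ ≤ _ := by rw [mul_assoc]; gcongr

lemma tendsto_add_ofReal_cobounded (b : ℝ) :
    Tendsto (fun u : ℂ => u + b) (cobounded ℂ ⊓ 𝓟 {u | 0 < u.re})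
      (cobounded ℂ ⊓ 𝓟 {u | b ≤ u.re}) := by
  refine tendsto_inf.2 ⟨Tendsto.mono_left ?_ inf_le_left, tendsto_principal.2 ?_⟩
  · rw [← tendsto_norm_atTop_iff_cobounded]
    refine tendsto_atTop_mono (fun u => ?_)
      (tendsto_atTop_add_const_right _ (-‖(b : ℂ)‖) tendsto_norm_cobounded_atTop)
    have := norm_sub_norm_le u (-b)
    rw [norm_neg, sub_neg_eq_add] at this
    linarith
  · filter_upwards [mem_inf_of_right (mem_principal_self _)] with u hu
    have hu : 0 < u.re := hu
    simpa using hu.le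

lemma tendsto_gammaQuot {b : ℝ} (hb : 0 < b) (α : ℝ) :
    Tendsto (fun u => exp (α * (b - 1 / 2) * log u) * gammaQuot b α u)
      (cobounded ℂ ⊓ 𝓟 {u | 0 < u.re}) (𝓝 (exp (-α * (Real.log (2 * Real.pi) / 2 : ℝ)))) := by
  -- The shift d = b - 1/2 absorbs the replacement of log(u+b) by log u in the power factor; the
  -- limit b cancels the -b in `logGamma_add_sub`.
  have h1 := tendsto_mul_log_add_sub_log b (b - 1 / 2)
  have h2 := (tendsto_stirlingRem hb).comp (tendsto_add_ofReal_cobounded b)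
  have h3 := (((h1.sub_const (b : ℂ)).add_const ((Real.log (2 * Real.pi) / 2 : ℝ) : ℂ)).add
    h2).const_mul (-α : ℂ)
  rw [sub_self, zero_add, add_zero] at h3
  refine ((continuous_exp.tendsto _).comp h3).congr fun u => ?_
  simp only [Function.comp_apply]
  rw [gammaQuot, logGamma_add_sub, ← exp_add]
  congr 1
  ring

lemma differentiableOn_mlCoeff {a b : ℝ} (ha : 0 < a) (α : ℝ) :
    DifferentiableOn ℂ (mlCoeff a b α) {s | -(b / a) < s.re} := by
  have : Set.MapsTo (fun s : ℂ => a * s + b) {s | -(b / a) < s.re} {u | 0 < u.re} := by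
    intro s hs
    have hs : -(b / a) < s.re := hs
    show 0 < (a * s + b : ℂ).re
    rw [add_re, re_ofReal_mul, ofReal_re]
    rw [← neg_div, div_lt_iff₀ ha] at hs
    linarith
  have h1 : DifferentiableOn ℂ (fun s : ℂ => logGamma (a * s + b)) {s | -(b / a) < s.re} :=
    differentiableOn_logGamma.comp (by fun_prop) this
  exact (h1.const_mul _).cexp

lemma differentiableOn_mlInterp {a b : ℝ} (ha : 0 < a) (α : ℝ) (z : ℂ) :
    DifferentiableOn ℂ (mlInterp a b α z) {s | -(b / a) < s.re} :=
  (differentiableOn_mlCoeff ha α).mul (by fun_prop)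

lemma mlTerm_eq_mlInterp {a b α : ℝ} (ha : 0 < a) (hb : 0 < b) {z : ℂ} (hz : z ≠ 0) (n : ℕ) :
    mlTerm a b α z n = mlInterp a b α z n := by
  have hpos : 0 < a * (n : ℝ) + b := by positivity
  have hG := Real.Gamma_pos_of_pos hpos
  rw [mlTerm, mlInterp, mlCoeff]
  rw [show (a * (n : ℂ) + b) = ((a * (n : ℝ) + b : ℝ) : ℂ) by push_cast; ring,
    logGamma_ofReal hpos, exp_nat_mul, exp_log hz, div_eq_inv_mul, Real.rpow_def_of_pos hG,
    ofReal_exp, ← exp_neg]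
  congr 2
  push_cast
  ring

lemma mlCoeff_eq_gammaQuot (a b α : ℝ) (s : ℂ) :
    mlCoeff a b α s = gammaQuot b α (a * s) * exp (-α * (a * s * log (a * s) - a * s)) := by
  rw [mlCoeff, gammaQuot, ← exp_add]
  congr 1
  ring

lemma exists_one_add_rpow_le_exp (p : ℝ) {δ : ℝ} (hδ : 0 < δ) :
    ∃ C, 0 < C ∧ ∀ x : ℝ, 0 ≤ x → (1 + x) ^ p ≤ C * Real.exp (δ * x) := by
  set q := |p| / δ + 1
  have hq : 0 < q := by positivity
  refine ⟨Real.exp (|p| * (Real.log q)), Real.exp_pos _, fun x hx => ?_⟩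
  rw [Real.rpow_def_of_pos (by positivity), ← Real.exp_add, Real.exp_le_exp]
  have h0 : 0 ≤ Real.log (1 + x) := Real.log_nonneg (by linarith)
  have h1 : Real.log (1 + x) ≤ Real.log q + x / q := by
    have h2 : (1 + x) ≤ q * (1 + x / q) := by
      have : q * (1 + x / q) = q + x := by field_simp
      rw [this]
      have : 0 ≤ |p| / δ := by positivity
      linarith
    have h3 := Real.log_le_log (by positivity) h2
    rw [Real.log_mul hq.ne' (by positivity)] at h3
    have h4 := Real.log_le_sub_one_of_pos (show 0 < 1 + x / q by positivity)
    linarith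
  have h5 : |p| * (x / q) ≤ δ * x := by
    have h6 : |p| ≤ δ * q := by
      have : δ * q = |p| + δ := by simp only [q]; field_simp
      linarith
    have : |p| / q ≤ δ := by rwa [div_le_iff₀ hq]
    calc _ = (|p| / q) * x := by ring
      _ ≤ _ := by gcongr
  calc _ ≤ |Real.log (1 + x) * p| := le_abs_self _
    _ = |p| * Real.log (1 + x) := by rw [abs_mul, abs_of_nonneg h0, mul_comm]
    _ ≤ |p| * (Real.log q + x / q) := by gcongr
    _ ≤ _ := by linarith

/-- For u = as one has -Re(u log u) = arg u · Im u - Re u · log|u|, with |arg u| ≤ π/2. This yields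
the rate aαπ/2 in |Im s| that decides the admissible sector; the power of 1+|u| is paid for by
exp(δ|s|). -/
lemma exists_norm_mlCoeff_le {a b α : ℝ} (ha : 0 < a) (hb : 0 < b) (hα : 0 < α) {δ : ℝ}
    (hδ : 0 < δ) : ∃ C, 0 < C ∧ ∀ s : ℂ, 0 ≤ s.re → ‖mlCoeff a b α s‖ ≤
      C * Real.exp (δ * ‖s‖ + Real.pi * (a * α) / 2 * |s.im|
        + s.re * (a * α - a * α * Real.log (a * ‖s‖))) := by
  obtain ⟨C, hC, h⟩ := exists_norm_gammaQuot_le hb hα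
  obtain ⟨D, hD, h'⟩ := exists_one_add_rpow_le_exp (-(α * (b - 1 / 2))) (div_pos hδ ha)
  refine ⟨C * D, by positivity, fun s hs => ?_⟩
  have hn : ‖(a * s : ℂ)‖ = a * ‖s‖ := by rw [norm_mul, norm_real, Real.norm_of_nonneg ha.le]
  have h1 := h (a * s) (by rw [re_ofReal_mul]; positivity)
  have h2 := h' (a * ‖s‖) (by positivity)
  rw [hn] at h1
  rw [mlCoeff_eq_gammaQuot, norm_mul]
  have h3 : ‖exp (-α * (a * s * log (a * s) - a * s))‖ ≤ Real.exp (Real.pi * (a * α) / 2 * |s.im|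
        + s.re * (a * α - a * α * Real.log (a * ‖s‖))) := by
    rw [norm_exp, Real.exp_le_exp]
    have harg : (a * s : ℂ).arg * s.im ≤ Real.pi / 2 * |s.im| := by
      have := abs_arg_le_pi_div_two_iff.2 (show 0 ≤ (a * s : ℂ).re by
        rw [re_ofReal_mul]; positivity)
      calc _ ≤ |(a * s : ℂ).arg * s.im| := le_abs_self _
        _ = |(a * s : ℂ).arg| * |s.im| := abs_mul _ _
        _ ≤ _ := by gcongr
    have e : (-α * (a * s * log (a * s) - a * s)).re =
        a * α * ((a * s : ℂ).arg * s.im) + s.re * (a * α - a * α * Real.log (a * ‖s‖)) := by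
      rw [← ofReal_neg, re_ofReal_mul, sub_re, mul_assoc, re_ofReal_mul, re_ofReal_mul, mul_re,
        log_re, log_im, hn]
      ring
    rw [e]
    have : 0 < a * α := by positivity
    nlinarith
  calc _ ≤ (C * (D * Real.exp (δ / a * (a * ‖s‖)))) * Real.exp (Real.pi * (a * α) / 2 * |s.im|
        + s.re * (a * α - a * α * Real.log (a * ‖s‖))) := by
        gcongr
        exact h1.trans (by gcongr)
    _ = _ := by
      rw [show δ / a * (a * ‖s‖) = δ * ‖s‖ by field_simp, add_assoc (δ * ‖s‖),
        Real.exp_add (δ * ‖s‖)]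
      ring

/-- The function `x ↦ x (B - c log (a r))` is bounded above for `0 ≤ x ≤ r`. -/
lemma mul_sub_log_le {a c : ℝ} (ha : 0 < a) (hc : 0 < c) (B : ℝ) {x r : ℝ} (hx : 0 ≤ x)
    (hxr : x ≤ r) : x * (B - c * Real.log (a * r)) ≤ c / a * Real.exp (B / c - 1) := by
  rcases le_or_gt (B - c * Real.log (a * r)) 0 with h | h
  · exact (mul_nonpos_of_nonneg_of_nonpos hx h).trans (by positivity)
  rcases (hx.trans hxr).eq_or_lt with rfl | hr
  · rw [le_antisymm hxr hx, zero_mul]; positivity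
  have hv : 0 < a * r := by positivity
  -- The maximum of r(B - c log(ar)) is at log(ar) = B/c - 1; this is the tangent inequality there.
  have h1 := Real.add_one_le_exp (B / c - 1 - Real.log (a * r))
  rw [Real.exp_sub _ (Real.log _), Real.exp_log hv, le_div_iff₀ hv] at h1
  calc _ ≤ r * (B - c * Real.log (a * r)) := by gcongr
    _ = c / a * ((B / c - 1 - Real.log (a * r) + 1) * (a * r)) := by field_simp; ring
    _ ≤ _ := by gcongr

lemma norm_exp_mul_log (z s : ℂ) :
    ‖exp (s * log z)‖ = Real.exp (s.re * Real.log ‖z‖ - s.im * arg z) := by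
  rw [norm_exp, mul_re, log_re, log_im]

lemma norm_mlInterp_le {a b α C δ : ℝ} {z s : ℂ} (h : ‖mlCoeff a b α s‖ ≤
      C * Real.exp (δ * ‖s‖ + Real.pi * (a * α) / 2 * |s.im|
        + s.re * (a * α - a * α * Real.log (a * ‖s‖)))) : ‖mlInterp a b α z s‖ ≤
      C * Real.exp (δ * ‖s‖ + (Real.pi * (a * α) / 2 + |arg z|) * |s.im|
        + s.re * (a * α + Real.log ‖z‖ - a * α * Real.log (a * ‖s‖))) := by
  have hC : 0 ≤ C := by
    by_contra hC
    exact absurd ((norm_nonneg _).trans h)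
      (not_le.2 (mul_neg_of_neg_of_pos (not_le.1 hC) (Real.exp_pos _)))
  rw [mlInterp, norm_mul, norm_exp_mul_log]
  refine (mul_le_mul_of_nonneg_right h (Real.exp_pos _).le).trans ?_
  rw [mul_assoc, ← Real.exp_add]
  refine mul_le_mul_of_nonneg_left (Real.exp_le_exp.2 ?_) hC
  have : -(s.im * arg z) ≤ |arg z| * |s.im| := by
    rw [← abs_mul, mul_comm (arg z)]; exact neg_le_abs _
  linarith

/-- In a proper subsector of the right half-plane, the interpolating function decays
exponentially. -/
lemma exists_norm_mlInterp_le_of_sector {a b α : ℝ} (ha : 0 < a) (hb : 0 < b) (hα : 0 < α)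
    (z : ℂ) {κ : ℝ} (hκ : 0 < κ) :
    ∃ C, ∀ s : ℂ, κ * ‖s‖ ≤ s.re → ‖mlInterp a b α z s‖ ≤ C * Real.exp (-‖s‖) := by
  obtain ⟨C, hC, h⟩ := exists_norm_mlCoeff_le ha hb hα one_pos
  have hc : 0 < a * α := by positivity
  -- M is the linear rate to beat: δ = 1, the angular growth, and 1 for the desired decay. Since
  -- M|s| ≤ (M/κ) Re s, it is moved into the constant B, which the term -aα Re s · log(a|s|)
  -- absorbs.
  set M := 1 + (Real.pi * (a * α) / 2 + |arg z|) + 1 with hM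
  set B := a * α + Real.log ‖z‖ + M / κ with hB
  refine ⟨C * Real.exp (a * α / a * Real.exp (B / (a * α) - 1)), fun s hs => ?_⟩
  have hs0 : 0 ≤ s.re := le_trans (by positivity) hs
  refine (norm_mlInterp_le (h s hs0)).trans ?_
  rw [mul_assoc C, ← Real.exp_add]
  refine mul_le_mul_of_nonneg_left (Real.exp_le_exp.2 ?_) hC.le
  have h1 := mul_sub_log_le ha hc B hs0 (re_le_norm s)
  have h2 : (Real.pi * (a * α) / 2 + |arg z|) * |s.im| ≤
      (Real.pi * (a * α) / 2 + |arg z|) * ‖s‖ := by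
    have := Real.pi_pos
    gcongr; exact abs_im_le_norm s
  have hM0 : 0 < M := by have := Real.pi_pos; positivity
  have h3 : M * ‖s‖ ≤ s.re * (M / κ) := by
    calc M * ‖s‖ = M / κ * (κ * ‖s‖) := by field_simp
      _ ≤ M / κ * s.re := by gcongr
      _ = _ := mul_comm _ _
  have e : s.re * (B - a * α * Real.log (a * ‖s‖)) =
    s.re * (a * α + Real.log ‖z‖ - a * α * Real.log (a * ‖s‖)) + s.re * (M / κ) := by
    rw [hB]; ring
  have e2 : M * ‖s‖ = 1 * ‖s‖ + (Real.pi * (a * α) / 2 + |arg z|) * ‖s‖ + ‖s‖ := by rw [hM]; ring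
  linarith

/-- In the closed right half-plane, the interpolating function times `exp (-2π |Im s|)` decays
exponentially if `π a α / 2 + |arg z| < 2π`. -/
lemma exists_norm_mlInterp_le {a b α : ℝ} (ha : 0 < a) (hb : 0 < b) (hα : 0 < α)
    {z : ℂ} {ε : ℝ} (hε : 0 < ε) (hz : Real.pi * (a * α) / 2 + |arg z| ≤ 2 * Real.pi - ε) :
    ∃ C, ∀ s : ℂ, 0 ≤ s.re → ‖mlInterp a b α z s‖ * Real.exp (-(2 * Real.pi * |s.im|)) ≤
      C * Real.exp (-(ε / 2 * ‖s‖)) := by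
  obtain ⟨C, hC, h⟩ := exists_norm_mlCoeff_le ha hb hα (half_pos hε)
  have hc : 0 < a * α := by positivity
  -- The gap ε in the angle controls |Im s|, and the ε added here controls Re s; together they give
  -- decay ε|s|, half of which is spent on δ = ε/2.
  set B := a * α + Real.log ‖z‖ + ε with hB
  refine ⟨C * Real.exp (a * α / a * Real.exp (B / (a * α) - 1)), fun s hs0 => ?_⟩
  refine (mul_le_mul_of_nonneg_right (norm_mlInterp_le (h s hs0)) (Real.exp_pos _).le).trans ?_
  rw [mul_assoc C, mul_assoc C, ← Real.exp_add, ← Real.exp_add]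
  refine mul_le_mul_of_nonneg_left (Real.exp_le_exp.2 ?_) hC.le
  have h1 := mul_sub_log_le ha hc B hs0 (re_le_norm s)
  have h2 : (Real.pi * (a * α) / 2 + |arg z|) * |s.im| ≤ (2 * Real.pi - ε) * |s.im| := by gcongr
  have h3 : ε * ‖s‖ ≤ ε * s.re + ε * |s.im| := by
    rw [← mul_add]
    have := norm_le_abs_re_add_abs_im s
    rw [abs_of_nonneg hs0] at this
    gcongr
  have e : s.re * (B - a * α * Real.log (a * ‖s‖)) =
    s.re * (a * α + Real.log ‖z‖ - a * α * Real.log (a * ‖s‖)) + ε * s.re := by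
    rw [hB]; ring
  linarith

/-! ### Rotation of a half-line of integration -/

lemma re_ofReal_mul_exp_mul_I (r ψ : ℝ) : (r * exp (ψ * I) : ℂ).re = r * Real.cos ψ := by
  rw [re_ofReal_mul, exp_ofReal_mul_I_re]

lemma norm_ofReal_mul_exp_mul_I {r : ℝ} (hr : 0 ≤ r) (ψ : ℝ) : ‖(r * exp (ψ * I) : ℂ)‖ = r := by
  rw [norm_mul, norm_exp_ofReal_mul_I, mul_one, norm_real, Real.norm_of_nonneg hr]

lemma abs_le_of_mem_uIcc_zero {φ ψ : ℝ} (h : ψ ∈ Set.uIcc 0 φ) : |ψ| ≤ |φ| := by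
  have := Set.abs_sub_left_of_mem_uIcc h
  simpa using this

/-- A large disc tangent to the line Re s = -η swallows any bounded part of the closed right
half-plane. It is needed because holomorphic functions have primitives on discs. -/
lemma exists_ball_subset {η : ℝ} (hη : 0 < η) (R : ℝ) : ∃ X : ℝ,
    Metric.ball (X : ℂ) (X + η) ⊆ {s | -η < s.re} ∧
      ∀ s : ℂ, 0 ≤ s.re → ‖s‖ ≤ R → s ∈ Metric.ball (X : ℂ) (X + η) := by
  have hX : 0 ≤ R ^ 2 / (2 * η) := by positivity
  refine ⟨R ^ 2 / (2 * η), fun s hs => ?_, fun s hs hR => ?_⟩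
  · rw [Metric.mem_ball, dist_eq_norm] at hs
    have := (abs_le.1 ((abs_re_le_norm _).trans hs.le)).1
    have h2 := (abs_lt.1 ((abs_re_le_norm _).trans_lt hs)).1
    rw [sub_re, ofReal_re] at h2
    show -η < s.re
    linarith
  · rw [Metric.mem_ball, dist_eq_norm, ← sq_lt_sq₀ (norm_nonneg _) (by positivity),
      Complex.sq_norm, normSq_apply]
    have h1 : ‖s‖ ^ 2 ≤ R ^ 2 := by gcongr
    rw [Complex.sq_norm, normSq_apply] at h1
    have h2 : R ^ 2 / (2 * η) * (2 * η) = R ^ 2 := by field_simp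
    simp only [sub_re, sub_im, ofReal_re, ofReal_im, sub_zero]
    nlinarith [mul_nonneg hX hs, sq_pos_of_pos hη]

lemma integrableOn_const_mul_exp_neg {δ : ℝ} (hδ : 0 < δ) (C : ℝ) :
    MeasureTheory.IntegrableOn (fun r : ℝ => C * Real.exp (-(δ * r))) (Set.Ioi 0) := by
  have := (integrableOn_exp_mul_Ioi (a := -δ) (by linarith) 0).const_mul C
  simp only [neg_mul] at this
  exact this

lemma continuousOn_ray {h : ℂ → ℂ} {η : ℝ} (hη : 0 < η)
    (hd : DifferentiableOn ℂ h {s | -η < s.re}) {ψ : ℝ} (hψ : |ψ| ≤ Real.pi / 2) :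
    ContinuousOn (fun r : ℝ => h (r * exp (ψ * I))) (Set.Ici 0) := by
  refine hd.continuousOn.comp (by fun_prop) fun r hr => ?_
  show -η < (r * exp (ψ * I) : ℂ).re
  rw [re_ofReal_mul_exp_mul_I]
  have h1 := abs_le.1 hψ
  have : 0 ≤ r * Real.cos ψ := mul_nonneg hr (Real.cos_nonneg_of_mem_Icc ⟨h1.1, h1.2⟩)
  linarith

lemma integrableOn_ray {h : ℂ → ℂ} {η : ℝ} (hη : 0 < η)
    (hd : DifferentiableOn ℂ h {s | -η < s.re}) {ψ C δ : ℝ} (hψ : |ψ| ≤ Real.pi / 2) (hδ : 0 < δ)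
    (hb : ∀ r : ℝ, 0 < r → ‖h (r * exp (ψ * I))‖ ≤ C * Real.exp (-(δ * r))) :
    MeasureTheory.IntegrableOn (fun r : ℝ => h (r * exp (ψ * I))) (Set.Ioi 0) := by
  refine (integrableOn_const_mul_exp_neg hδ C).mono'
    (((continuousOn_ray hη hd hψ).mono Set.Ioi_subset_Ici_self).aestronglyMeasurable
      measurableSet_Ioi) ?_
  exact (MeasureTheory.ae_restrict_iff' measurableSet_Ioi).2 (Eventually.of_forall hb)

/-- The integral of an exponentially decaying holomorphic function along a ray does not depend
on the ray. -/
theorem integral_Ioi_eq_integral_ray {h : ℂ → ℂ} {η : ℝ} (hη : 0 < η)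
    (hd : DifferentiableOn ℂ h {s | -η < s.re}) {φ C δ : ℝ} (hφ : |φ| ≤ Real.pi / 2) (hδ : 0 < δ)
    (hb : ∀ r : ℝ, 0 < r → ∀ ψ ∈ Set.uIcc 0 φ,
      ‖h (r * exp (ψ * I))‖ ≤ C * Real.exp (-(δ * r))) :
    ∫ r in Set.Ioi (0 : ℝ), h r = exp (φ * I) * ∫ r in Set.Ioi (0 : ℝ), h (r * exp (φ * I)) := by
  have hψ : ∀ ψ ∈ Set.uIcc 0 φ, |ψ| ≤ Real.pi / 2 := fun ψ hψ =>
    (abs_le_of_mem_uIcc_zero hψ).trans hφ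
  have hlim : ∀ ψ ∈ Set.uIcc 0 φ, Tendsto (fun R : ℝ => ∫ r in (0 : ℝ)..R, h (r * exp (ψ * I)))
      atTop (𝓝 (∫ r in Set.Ioi (0 : ℝ), h (r * exp (ψ * I)))) := fun ψ hm =>
    MeasureTheory.intervalIntegral_tendsto_integral_Ioi 0
      (integrableOn_ray hη hd (hψ ψ hm) hδ fun r hr => hb r hr ψ hm) tendsto_id
  have h0 := hlim 0 Set.left_mem_uIcc
  have h1 := (hlim φ Set.right_mem_uIcc).const_mul (exp (φ * I))
  simp only [ofReal_zero, zero_mul, exp_zero, mul_one] at h0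
  refine tendsto_nhds_unique h0 (h1.congr_dist ?_)
  -- With a primitive g, both truncated integrals are increments of g from 0. They differ by its
  -- increment along the arc of radius R and length R|φ|.
  refine squeeze_zero' (g := fun R => C * Real.exp (-(δ * R)) * R * |φ|)
    (Eventually.of_forall fun _ => dist_nonneg) ?_ ?_
  · filter_upwards [eventually_gt_atTop 0] with R hR
    obtain ⟨X, hX1, hX2⟩ := exists_ball_subset hη R
    obtain ⟨g, hg⟩ := (hd.mono hX1).isExactOn_ball
    have hmem : ∀ ψ ∈ Set.uIcc 0 φ, ∀ r ∈ Set.Icc 0 R,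
        (r * exp (ψ * I) : ℂ) ∈ Metric.ball (X : ℂ) (X + η) := fun ψ hm r hr => by
      have h2 := abs_le.1 (hψ ψ hm)
      refine hX2 _ ?_ ?_
      · rw [re_ofReal_mul_exp_mul_I]
        exact mul_nonneg hr.1 (Real.cos_nonneg_of_mem_Icc ⟨h2.1, h2.2⟩)
      · rw [norm_ofReal_mul_exp_mul_I hr.1]; exact hr.2
    have hint : ∀ ψ ∈ Set.uIcc 0 φ, exp (ψ * I) * ∫ r in (0 : ℝ)..R, h (r * exp (ψ * I)) =
        g (R * exp (ψ * I)) - g 0 := fun ψ hm => by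
      rw [← intervalIntegral.integral_const_mul]
      rw [intervalIntegral.integral_eq_sub_of_hasDerivAt
        (f := fun r : ℝ => g (r * exp (ψ * I)))]
      · simp
      · intro r hr
        rw [Set.uIcc_of_le hR.le] at hr
        have h3 : HasDerivAt (fun r : ℝ => (r * exp (ψ * I) : ℂ)) (exp (ψ * I)) r := by
          simpa using (ofRealCLM.hasDerivAt (x := r)).mul_const (exp (ψ * I))
        exact ((hg _ (hmem ψ hm r hr)).comp r h3).congr_deriv (mul_comm _ _)
      · refine ContinuousOn.intervalIntegrable ?_
        rw [Set.uIcc_of_le hR.le]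
        exact continuousOn_const.mul ((continuousOn_ray hη hd (hψ ψ hm)).mono
          Set.Icc_subset_Ici_self)
    have e0 := hint 0 Set.left_mem_uIcc
    simp only [ofReal_zero, zero_mul, exp_zero, mul_one, one_mul] at e0
    rw [hint φ Set.right_mem_uIcc, e0, dist_eq_norm, sub_sub_sub_cancel_right]
    have := Convex.norm_image_sub_le_of_norm_hasDerivWithin_le (𝕜 := ℝ)
      (f := fun ψ : ℝ => g (R * exp (ψ * I)))
      (f' := fun ψ : ℝ => h (R * exp (ψ * I)) * (R * (exp (ψ * I) * I)))
      (s := Set.uIcc 0 φ) (x := 0) (y := φ) (C := C * Real.exp (-(δ * R)) * R) (fun ψ hm => by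
        have h4 : HasDerivAt (fun ψ : ℝ => (R * exp (ψ * I) : ℂ)) (R * (exp (ψ * I) * I)) ψ := by
          have h5 : HasDerivAt (fun ψ : ℝ => (ψ * I : ℂ)) I ψ := by
            simpa using (ofRealCLM.hasDerivAt (x := ψ)).mul_const I
          exact h5.cexp.const_mul _
        exact ((hg _ (hmem ψ hm R ⟨hR.le, le_rfl⟩)).comp ψ h4).hasDerivWithinAt)
      (fun ψ hm => by
        have h6 : ‖(R * (exp (ψ * I) * I) : ℂ)‖ = R := by
          rw [norm_mul, norm_mul, norm_exp_ofReal_mul_I, norm_I, norm_real,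
            Real.norm_of_nonneg hR.le]; ring
        rw [norm_mul, h6]
        gcongr
        exact hb R hR ψ hm) (convex_uIcc 0 φ) Set.left_mem_uIcc Set.right_mem_uIcc
    simp only [ofReal_zero, zero_mul, exp_zero, mul_one, sub_zero, Real.norm_eq_abs] at this
    exact this
  · have : Tendsto (fun R : ℝ => R * Real.exp (-(δ * R))) atTop (𝓝 0) := by
      simpa [neg_mul] using tendsto_rpow_mul_exp_neg_mul_atTop_nhds_zero 1 δ hδ
    have := (this.const_mul C).mul_const |φ|
    simp only [mul_zero, zero_mul] at this
    exact this.congr fun R => by ring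

/-! ### Comparison of the series with an integral by Poisson summation -/

/-- The interpolating function, normalized to vanish at `0`. -/
noncomputable def mlDiff (a b α : ℝ) (z s : ℂ) : ℂ :=
  mlInterp a b α z s - mlCoeff a b α 0 * exp (-s)

lemma mlDiff_zero (a b α : ℝ) (z : ℂ) : mlDiff a b α z 0 = 0 := by
  simp [mlDiff, mlInterp]

lemma differentiableOn_mlDiff {a b : ℝ} (ha : 0 < a) (α : ℝ) (z : ℂ) :
    DifferentiableOn ℂ (mlDiff a b α z) {s | -(b / a) < s.re} :=
  (differentiableOn_mlInterp ha α z).sub (by fun_prop)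

lemma norm_exp_sub_one_le (w : ℂ) : ‖exp w - 1‖ ≤ ‖w‖ * Real.exp |w.re| := by
  have := norm_image_sub_le_of_norm_deriv_le_segment_01'
    (f := fun t : ℝ => exp (t * w)) (f' := fun t : ℝ => exp (t * w) * w)
    (C := ‖w‖ * Real.exp |w.re|) (fun t _ => by
      have h : HasDerivAt (fun t : ℝ => (t * w : ℂ)) w t := by
        simpa using (ofRealCLM.hasDerivAt (x := t)).mul_const w
      exact h.cexp.hasDerivWithinAt) (fun t ht => by
      rw [norm_mul, norm_exp, re_ofReal_mul, mul_comm]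
      gcongr
      calc t * w.re ≤ t * |w.re| := by gcongr; exacts [ht.1, le_abs_self _]
        _ ≤ 1 * |w.re| := by gcongr; exact ht.2.le
        _ = _ := one_mul _)
  simpa using this

lemma exists_norm_mlDiff_le {a b α : ℝ} (ha : 0 < a) (hb : 0 < b) (hα : 0 < α)
    {z : ℂ} {ε : ℝ} (hε : 0 < ε) (hz : Real.pi * (a * α) / 2 + |arg z| ≤ 2 * Real.pi - ε) :
    ∃ C, 0 ≤ C ∧ ∀ s : ℂ, 0 ≤ s.re → ‖mlDiff a b α z s‖ * Real.exp (-(2 * Real.pi * |s.im|)) ≤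
      C * Real.exp (-(min (ε / 2) 1 * ‖s‖)) := by
  obtain ⟨C, hC⟩ := exists_norm_mlInterp_le ha hb hα hε hz
  refine ⟨|C| + ‖mlCoeff a b α 0‖, by positivity, fun s hs => ?_⟩
  have h1 : ‖mlDiff a b α z s‖ ≤ ‖mlInterp a b α z s‖ + ‖mlCoeff a b α 0‖ * Real.exp (-s.re) := by
    refine (norm_sub_le _ _).trans ?_
    rw [norm_mul, norm_exp, neg_re]
  have h2 : Real.exp (-s.re) * Real.exp (-(2 * Real.pi * |s.im|)) ≤ Real.exp (-‖s‖) := by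
    rw [← Real.exp_add, Real.exp_le_exp]
    have h3 := norm_le_abs_re_add_abs_im s
    rw [abs_of_nonneg hs] at h3
    have : |s.im| ≤ 2 * Real.pi * |s.im| := by
      have := Real.pi_gt_three
      nlinarith [abs_nonneg s.im]
    linarith
  have h4 : Real.exp (-‖s‖) ≤ Real.exp (-(min (ε / 2) 1 * ‖s‖)) := by
    rw [Real.exp_le_exp]
    have := mul_le_mul_of_nonneg_right (min_le_right (ε / 2) 1) (norm_nonneg s)
    linarith
  have h5 : Real.exp (-(ε / 2 * ‖s‖)) ≤ Real.exp (-(min (ε / 2) 1 * ‖s‖)) := by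
    rw [Real.exp_le_exp]
    have := mul_le_mul_of_nonneg_right (min_le_left (ε / 2) 1) (norm_nonneg s)
    linarith
  calc _ ≤ (‖mlInterp a b α z s‖ + ‖mlCoeff a b α 0‖ * Real.exp (-s.re)) *
        Real.exp (-(2 * Real.pi * |s.im|)) := by gcongr
    _ = ‖mlInterp a b α z s‖ * Real.exp (-(2 * Real.pi * |s.im|)) +
        ‖mlCoeff a b α 0‖ * (Real.exp (-s.re) * Real.exp (-(2 * Real.pi * |s.im|))) := by ring
    _ ≤ |C| * Real.exp (-(ε / 2 * ‖s‖)) + ‖mlCoeff a b α 0‖ * Real.exp (-‖s‖) := by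
      refine add_le_add ((hC s hs).trans ?_) (by gcongr)
      gcongr
      exact le_abs_self C
    _ ≤ |C| * Real.exp (-(min (ε / 2) 1 * ‖s‖)) +
        ‖mlCoeff a b α 0‖ * Real.exp (-(min (ε / 2) 1 * ‖s‖)) := by gcongr
    _ = _ := by ring

/-- The difference quotient at 0 extends continuously to 0, hence is bounded on a compact segment of
the imaginary axis. -/
lemma exists_norm_mlCoeff_sub_le {a b : ℝ} (ha : 0 < a) (hb : 0 < b) (α : ℝ) :
    ∃ K, ∀ y : ℝ, |y| ≤ 1 → ‖mlCoeff a b α (y * I) - mlCoeff a b α 0‖ ≤ K * |y| := by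
  have hU : IsOpen {s : ℂ | -(b / a) < s.re} := isOpen_lt continuous_const continuous_re
  have hba : 0 < b / a := by positivity
  have h0 : (0 : ℂ) ∈ {s : ℂ | -(b / a) < s.re} := by
    show -(b / a) < (0 : ℂ).re
    simpa using hba
  have hd := differentiableOn_mlCoeff (b := b) ha α
  have hc : ContinuousOn (dslope (mlCoeff a b α) 0) {s : ℂ | -(b / a) < s.re} :=
    (continuousOn_dslope (hU.mem_nhds h0)).2
      ⟨hd.continuousOn, hd.differentiableAt (hU.mem_nhds h0)⟩
  have hc' : ContinuousOn (fun y : ℝ => dslope (mlCoeff a b α) 0 (y * I)) (Set.Icc (-1) 1) := by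
    refine hc.comp (by fun_prop) fun y _ => ?_
    show -(b / a) < (y * I : ℂ).re
    simpa using hba
  obtain ⟨K, hK⟩ := isCompact_Icc.exists_bound_of_continuousOn hc'
  refine ⟨K, fun y hy => ?_⟩
  have h1 := sub_smul_dslope (mlCoeff a b α) 0 (y * I)
  rw [← h1, norm_smul, sub_zero, norm_mul, norm_I, mul_one, norm_real, Real.norm_eq_abs, mul_comm]
  gcongr
  exact hK y (abs_le.1 hy)

/-- A bound on the imaginary axis, uniform in `z`. -/
lemma exists_norm_mlDiff_mul_I_le {a b α : ℝ} (ha : 0 < a) (hb : 0 < b) (hα : 0 < α)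
    {ε : ℝ} (hε : 0 < ε) :
    ∃ C, 0 ≤ C ∧ ∀ z : ℂ, 1 ≤ ‖z‖ → Real.pi * (a * α) / 2 + |arg z| ≤ 2 * Real.pi - ε →
      ∀ y : ℝ, ‖mlDiff a b α z (y * I)‖ ≤
        C * (1 + Real.log ‖z‖) * (|y| * Real.exp ((2 * Real.pi - ε / 2) * |y|)) := by
  obtain ⟨C, hC, h⟩ := exists_norm_mlCoeff_le ha hb hα (half_pos hε)
  obtain ⟨K, hK⟩ := exists_norm_mlCoeff_sub_le ha hb α
  set F := ‖mlCoeff a b α 0‖ with hF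
  have hF0 : 0 ≤ F := norm_nonneg _
  have hpi := Real.pi_pos
  have hc : 0 < a * α := by positivity
  refine ⟨C + F + (|K| * Real.exp Real.pi + F * ((1 + Real.pi) * Real.exp Real.pi) + F),
    by positivity, fun z hz hzε y => ?_⟩
  have hlog : 0 ≤ Real.log ‖z‖ := Real.log_nonneg hz
  have hpos : 0 ≤ 2 * Real.pi - ε / 2 := by
    have : 0 ≤ Real.pi * (a * α) / 2 + |arg z| := by positivity
    linarith
  set E := Real.exp ((2 * Real.pi - ε / 2) * |y|) with hE
  have hE1 : 1 ≤ E := Real.one_le_exp (by positivity)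
  have hnz : ‖exp (y * I * log z)‖ = Real.exp (-(y * arg z)) := by
    rw [norm_exp_mul_log]; simp
  have hle : ∀ θ : ℝ, -(y * θ) ≤ |θ| * |y| := fun θ => by
    rw [← abs_mul, mul_comm θ]; exact neg_le_abs _
  -- Near 0 the factor |y| comes from the vanishing of `mlDiff` at 0, the derivative of z^(iy)
  -- costing log|z|. For |y| > 1 the growth bound suffices.
  rcases le_or_gt |y| 1 with hy | hy
  · have h1 : Real.exp (-(y * arg z)) ≤ Real.exp Real.pi := by
      rw [Real.exp_le_exp]
      calc _ ≤ |arg z| * |y| := hle _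
        _ ≤ Real.pi * 1 := by gcongr; exact abs_arg_le_pi z
        _ = _ := mul_one _
    have h2 : ‖exp (y * I * log z) - 1‖ ≤
        |y| * ((1 + Real.pi) * (1 + Real.log ‖z‖)) * Real.exp Real.pi := by
      refine (norm_exp_sub_one_le _).trans ?_
      have e1 : (y * I * log z).re = -(y * arg z) := by simp [mul_re, log_im]
      have e2 : ‖log z‖ ≤ (1 + Real.pi) * (1 + Real.log ‖z‖) := by
        have := norm_le_abs_re_add_abs_im (log z)
        rw [log_re, log_im, abs_of_nonneg hlog] at this
        nlinarith [abs_arg_le_pi z, mul_nonneg hpi.le hlog]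
      rw [e1, norm_mul, norm_mul, norm_I, mul_one, norm_real, Real.norm_eq_abs]
      gcongr
      rw [abs_neg, abs_mul]
      calc _ ≤ 1 * Real.pi := by gcongr; exact abs_arg_le_pi z
        _ = _ := one_mul _
    have h3 : ‖1 - exp (-(y * I) : ℂ)‖ ≤ |y| := by
      rw [norm_sub_rev]
      refine (norm_exp_sub_one_le _).trans ?_
      simp
    have e : mlDiff a b α z (y * I) = (mlCoeff a b α (y * I) - mlCoeff a b α 0) *
        exp (y * I * log z) + mlCoeff a b α 0 * (exp (y * I * log z) - 1) +
        mlCoeff a b α 0 * (1 - exp (-(y * I))) := by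
      rw [mlDiff, mlInterp]; ring
    have h4 : ‖mlDiff a b α z (y * I)‖ ≤ |K| * |y| * Real.exp Real.pi +
        F * (|y| * ((1 + Real.pi) * (1 + Real.log ‖z‖)) * Real.exp Real.pi) + F * |y| := by
      rw [e]
      refine (norm_add₃_le ..).trans ?_
      rw [norm_mul, norm_mul, norm_mul, hnz]
      gcongr
      exact (hK y hy).trans (by gcongr; exact le_abs_self K)
    have h5 : |y| ≤ |y| * E := le_mul_of_one_le_right (abs_nonneg y) hE1
    calc _ ≤ _ := h4
      _ = (|K| * Real.exp Real.pi * 1 + F * ((1 + Real.pi) * Real.exp Real.pi) *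
          (1 + Real.log ‖z‖) + F * 1) * |y| := by ring
      _ ≤ (|K| * Real.exp Real.pi * (1 + Real.log ‖z‖) + F * ((1 + Real.pi) * Real.exp Real.pi) *
          (1 + Real.log ‖z‖) + F * (1 + Real.log ‖z‖)) * (|y| * E) := by
        gcongr <;> linarith
      _ = (0 + (|K| * Real.exp Real.pi + F * ((1 + Real.pi) * Real.exp Real.pi) + F)) *
          (1 + Real.log ‖z‖) * (|y| * E) := by ring
      _ ≤ _ := by gcongr; positivity
  · have h1 := norm_mlInterp_le (z := z) (h (y * I) (by simp))
    have h2 : ‖mlInterp a b α z (y * I)‖ ≤ C * E := by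
      refine h1.trans ?_
      rw [hE]
      gcongr
      simp only [norm_mul, norm_I, mul_one, norm_real, Real.norm_eq_abs, mul_re, ofReal_re, I_re,
        mul_zero, ofReal_im, I_im, sub_self, zero_mul, add_zero, mul_im]
      nlinarith [abs_nonneg y]
    have h3 : ‖mlDiff a b α z (y * I)‖ ≤ C * E + F := by
      refine (norm_sub_le _ _).trans ?_
      rw [norm_mul (mlCoeff a b α 0), norm_exp]
      simpa [← hF] using h2
    calc _ ≤ C * E + F * E := h3.trans (by gcongr; exact le_mul_of_one_le_right hF0 hE1)
      _ = (C + F + 0) * 1 * (1 * E) := by ring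
      _ ≤ _ := by gcongr; positivity; linarith

lemma integral_mul_exp_neg {β : ℝ} (hβ : 0 < β) :
    ∫ r in Set.Ioi (0 : ℝ), r * Real.exp (-(β * r)) = 1 / β ^ 2 := by
  have := Real.integral_rpow_mul_exp_neg_mul_Ioi (a := 2) (r := β) two_pos hβ
  rw [show (2 : ℝ) - 1 = 1 by norm_num] at this
  simp only [Real.rpow_one, Real.Gamma_two, mul_one] at this
  rw [this, Real.rpow_two]
  field_simp

lemma integrableOn_mul_exp_neg {β : ℝ} (hβ : 0 < β) :
    MeasureTheory.IntegrableOn (fun r => r * Real.exp (-(β * r))) (Set.Ioi (0 : ℝ)) := by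
  -- A non-integrable function would have integral 0 by convention, contradicting the value 1/β².
  by_contra h
  have := MeasureTheory.integral_undef h
  rw [integral_mul_exp_neg hβ] at this
  exact absurd this (by positivity)

/-- The Fourier coefficients, of either sign, after rotation to the imaginary axis. -/
lemma exists_norm_integral_mlDiff_le {a b α : ℝ} (ha : 0 < a) (hb : 0 < b) (hα : 0 < α)
    {ε : ℝ} (hε : 0 < ε) :
    ∃ C, 0 ≤ C ∧ ∀ z : ℂ, 1 ≤ ‖z‖ → Real.pi * (a * α) / 2 + |arg z| ≤ 2 * Real.pi - ε →
      ∀ σ : ℝ, |σ| = 1 → ∀ m : ℝ, 1 ≤ m →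
      ‖∫ x in Set.Ioi (0 : ℝ), exp (-2 * Real.pi * I * (σ * m) * x) * mlDiff a b α z x‖ ≤
        C * (1 + Real.log ‖z‖) * (1 / m ^ 2) := by
  obtain ⟨C, hC, h⟩ := exists_norm_mlDiff_mul_I_le ha hb hα hε
  refine ⟨C * (1 / (ε / 2) ^ 2), by positivity, fun z hz hzε σ hσ m hm => ?_⟩
  have hpi := Real.pi_pos
  have hlog : 0 ≤ Real.log ‖z‖ := Real.log_nonneg hz
  have hσ2 : σ * σ = 1 := by rw [← abs_mul_abs_self, hσ, one_mul]
  obtain ⟨D, hD0, hD⟩ := exists_norm_mlDiff_le ha hb hα hε hzε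
  have hφ : |-(σ * (Real.pi / 2))| ≤ Real.pi / 2 := by
    rw [abs_neg, abs_mul, hσ, one_mul, abs_of_pos (by positivity)]
  -- Rotating against the sign σ makes the kernel have modulus exp(-2πm|Im s|) on every intermediate
  -- ray; as m ≥ 1, this compensates the growth of `mlDiff`.
  have hsin : ∀ ψ ∈ Set.uIcc 0 (-(σ * (Real.pi / 2))), σ * Real.sin ψ = -|Real.sin ψ| := by
    intro ψ hψ
    rcases abs_eq (by norm_num : (0 : ℝ) ≤ 1) |>.1 hσ with rfl | rfl
    · rw [one_mul, Set.uIcc_of_ge (by linarith)] at hψ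
      rw [abs_of_nonpos (Real.sin_nonpos_of_nonpos_of_neg_pi_le hψ.2 (by linarith [hψ.1]))]; ring
    · rw [neg_one_mul, neg_neg, Set.uIcc_of_le (by linarith)] at hψ
      rw [abs_of_nonneg (Real.sin_nonneg_of_nonneg_of_le_pi hψ.1 (by linarith [hψ.2]))]; ring
  have hrot := integral_Ioi_eq_integral_ray (h := fun s => exp (-2 * Real.pi * I * (σ * m) * s) *
      mlDiff a b α z s) (div_pos hb ha)
    (DifferentiableOn.mul (by fun_prop) (differentiableOn_mlDiff ha α z)) hφ
    (δ := min (ε / 2) 1) (C := D) (by positivity) (fun r hr ψ hψ => by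
      have hc : 0 ≤ (r * exp (ψ * I) : ℂ).re := by
        rw [re_ofReal_mul_exp_mul_I]
        have h1 := abs_le.1 ((abs_le_of_mem_uIcc_zero hψ).trans hφ)
        exact mul_nonneg hr.le (Real.cos_nonneg_of_mem_Icc ⟨h1.1, h1.2⟩)
      have h1 := hD _ hc
      have him : (r * exp (ψ * I) : ℂ).im = r * Real.sin ψ := by
        rw [im_ofReal_mul, exp_ofReal_mul_I_im]
      rw [norm_ofReal_mul_exp_mul_I hr.le, him, abs_mul, abs_of_pos hr] at h1
      refine le_trans ?_ h1
      rw [norm_mul, mul_comm]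
      gcongr
      rw [norm_exp, Real.exp_le_exp]
      have e : (-2 * Real.pi * I * (σ * m) * (r * exp (ψ * I)) : ℂ).re =
          2 * Real.pi * m * (σ * (r * exp (ψ * I) : ℂ).im) := by
        rw [show (-2 * Real.pi * I * (σ * m) * (r * exp (ψ * I)) : ℂ) =
          ((-2 * Real.pi * σ * m : ℝ) : ℂ) * (I * (r * exp (ψ * I))) by push_cast; ring,
          re_ofReal_mul, I_mul_re]
        ring
      rw [e, him, show σ * (r * Real.sin ψ) = r * (σ * Real.sin ψ) by ring, hsin ψ hψ]
      have h2 : 0 ≤ r * |Real.sin ψ| := by positivity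
      nlinarith [mul_nonneg (mul_nonneg hpi.le h2) (sub_nonneg.2 hm)])
  rw [hrot, norm_mul, norm_exp_ofReal_mul_I, one_mul]
  have hexp : exp ((-(σ * (Real.pi / 2)) : ℝ) * I) = ((-σ : ℝ) : ℂ) * I := by
    rcases abs_eq (by norm_num : (0 : ℝ) ≤ 1) |>.1 hσ with rfl | rfl
    · push_cast
      rw [one_mul, neg_mul, exp_neg, exp_pi_div_two_mul_I, inv_I]; ring
    · push_cast
      rw [neg_one_mul, neg_neg, exp_pi_div_two_mul_I]; ring
  rw [hexp]
  have hε4 : ε / 2 ≤ 2 * Real.pi := by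
    have : 0 ≤ Real.pi * (a * α) / 2 + |arg z| := by positivity
    linarith
  set β := 2 * Real.pi * m - (2 * Real.pi - ε / 2) with hβ
  -- The difference of the two sides is (m - 1)(2π - ε/2) ≥ 0. Hence 1/β² is O(1/m²), which is
  -- summable over the frequencies.
  have hβm : ε / 2 * m ≤ β := by nlinarith
  have hβ0 : 0 < β := lt_of_lt_of_le (by positivity) hβm
  refine (MeasureTheory.norm_integral_le_of_norm_le
    ((integrableOn_mul_exp_neg hβ0).const_mul (C * (1 + Real.log ‖z‖)))
    ((MeasureTheory.ae_restrict_iff' measurableSet_Ioi).2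
      (Eventually.of_forall fun r hr => ?_))).trans ?_
  · have hr : 0 < r := hr
    have h1 := h z hz hzε (r * -σ)
    rw [abs_mul, abs_neg, hσ, mul_one, abs_of_pos hr] at h1
    have e : (r * (((-σ : ℝ) : ℂ) * I) : ℂ) = ((r * -σ : ℝ) : ℂ) * I := by push_cast; ring
    have e2 : (-2 * Real.pi * I * (σ * m) * (((r * -σ : ℝ) : ℂ) * I)) =
        ((-(2 * Real.pi * m * r) : ℝ) : ℂ) := by
      have : (σ * σ : ℂ) = 1 := by exact_mod_cast hσ2
      push_cast
      linear_combination (2 * Real.pi * m * r * (σ * σ)) * I_mul_I - (2 * Real.pi * m * r) * this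
    rw [e, norm_mul, e2, ← ofReal_exp, norm_real, Real.norm_of_nonneg (Real.exp_pos _).le]
    calc _ ≤ Real.exp (-(2 * Real.pi * m * r)) * (C * (1 + Real.log ‖z‖) *
          (r * Real.exp ((2 * Real.pi - ε / 2) * r))) := by gcongr
      _ = C * (1 + Real.log ‖z‖) * (r * (Real.exp (-(2 * Real.pi * m * r)) *
          Real.exp ((2 * Real.pi - ε / 2) * r))) := by ring
      _ = _ := by
        rw [← Real.exp_add, hβ]
        congr 3
        ring_nf
  · rw [MeasureTheory.integral_const_mul, integral_mul_exp_neg hβ0]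
    calc _ ≤ C * (1 + Real.log ‖z‖) * (1 / (ε / 2 * m) ^ 2) := by gcongr
      _ = _ := by rw [mul_pow]; field_simp

/-! ### Poisson summation for the extension by zero -/

open FourierTransform

lemma summable_exp_neg_mul_nat {δ : ℝ} (hδ : 0 < δ) :
    Summable fun n : ℕ => Real.exp (-(δ * n)) := by
  refine (summable_geometric_of_lt_one (Real.exp_pos (-δ)).le
    (by rw [← Real.exp_zero, Real.exp_lt_exp]; linarith)).congr fun n => ?_
  rw [← Real.exp_nat_mul]
  congr 1
  ring

lemma exists_norm_mlInterp_ofReal_le {a b α : ℝ} (ha : 0 < a) (hb : 0 < b) (hα : 0 < α) (z : ℂ) :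
    ∃ C, ∀ x : ℝ, 0 ≤ x → ‖mlInterp a b α z x‖ ≤ C * Real.exp (-(1 * x)) := by
  obtain ⟨C, hC⟩ := exists_norm_mlInterp_le_of_sector ha hb hα z one_pos
  refine ⟨C, fun x hx => ?_⟩
  have := hC x (by simp [abs_of_nonneg hx])
  rw [norm_real, Real.norm_of_nonneg hx] at this
  rwa [one_mul]

lemma summable_mlInterp {a b α : ℝ} (ha : 0 < a) (hb : 0 < b) (hα : 0 < α) (z : ℂ) :
    Summable fun n : ℕ => mlInterp a b α z n := by
  obtain ⟨C, hC⟩ := exists_norm_mlInterp_ofReal_le ha hb hα z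
  exact Summable.of_norm_bounded ((summable_exp_neg_mul_nat one_pos).mul_left C)
    (fun n => by simpa using hC n (Nat.cast_nonneg n))

lemma summable_mlTerm {a b α : ℝ} (ha : 0 < a) (hb : 0 < b) (hα : 0 < α) (z : ℂ) :
    Summable (mlTerm a b α z) := by
  rcases eq_or_ne z 0 with rfl | hz
  · refine summable_of_ne_finset_zero (s := {0}) fun n hn => ?_
    have hn : n ≠ 0 := by simpa using hn
    simp [mlTerm, hn]
  · exact (summable_mlInterp ha hb hα z).congr fun n => (mlTerm_eq_mlInterp ha hb hz n).symm

lemma mlF_eq_tsum_mlInterp {a b α : ℝ} (ha : 0 < a) (hb : 0 < b) {z : ℂ} (hz : z ≠ 0) :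
    mlF a b α z = ∑' n : ℕ, mlInterp a b α z n :=
  tsum_congr fun n => mlTerm_eq_mlInterp ha hb hz n

lemma integrableOn_mlInterp {a b α : ℝ} (ha : 0 < a) (hb : 0 < b) (hα : 0 < α) (z : ℂ) :
    MeasureTheory.IntegrableOn (fun x : ℝ => mlInterp a b α z x) (Set.Ioi 0) := by
  obtain ⟨C, hC⟩ := exists_norm_mlInterp_ofReal_le ha hb hα z
  have := integrableOn_ray (ψ := 0) (div_pos hb ha) (differentiableOn_mlInterp ha α z)
    (by simpa using Real.pi_div_two_pos.le) one_pos (C := C) (fun r hr => by simpa using hC r hr.le)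
  simpa using this

/-- The extension by zero of `mlDiff` to the real line. -/
noncomputable def mlDiffExt (a b α : ℝ) (z : ℂ) (x : ℝ) : ℂ := mlDiff a b α z (max x 0 : ℝ)

lemma mlDiffExt_of_nonpos (a b α : ℝ) (z : ℂ) {x : ℝ} (hx : x ≤ 0) : mlDiffExt a b α z x = 0 := by
  rw [mlDiffExt, max_eq_right hx, ofReal_zero, mlDiff_zero]

lemma mlDiffExt_of_nonneg (a b α : ℝ) (z : ℂ) {x : ℝ} (hx : 0 ≤ x) :
    mlDiffExt a b α z x = mlDiff a b α z x := by
  rw [mlDiffExt, max_eq_left hx]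

lemma continuous_mlDiffExt {a b : ℝ} (ha : 0 < a) (hb : 0 < b) (α : ℝ) (z : ℂ) :
    Continuous (mlDiffExt a b α z) := by
  refine (differentiableOn_mlDiff (b := b) ha α z).continuousOn.comp_continuous (by fun_prop)
    fun x => ?_
  show -(b / a) < ((max x 0 : ℝ) : ℂ).re
  rw [ofReal_re]
  have : 0 < b / a := by positivity
  linarith [le_max_right x 0]

/-- Poisson summation requires decay of some order above 1; order 2 follows from t²/2 ≤ e^t with t =
δx. -/
lemma isBigO_mlDiffExt {a b α : ℝ} (ha : 0 < a) (hb : 0 < b) (hα : 0 < α)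
    {z : ℂ} {ε : ℝ} (hε : 0 < ε) (hz : Real.pi * (a * α) / 2 + |arg z| ≤ 2 * Real.pi - ε) :
    mlDiffExt a b α z =O[cocompact ℝ] fun x : ℝ => |x| ^ (-2 : ℝ) := by
  obtain ⟨C, hC0, hC⟩ := exists_norm_mlDiff_le ha hb hα hε hz
  set δ := min (ε / 2) 1
  have hδ : 0 < δ := by positivity
  refine IsBigO.of_bound (C * (2 / δ ^ 2)) (Eventually.of_forall fun x => ?_)
  rcases le_or_gt x 0 with hx | hx
  · rw [mlDiffExt_of_nonpos a b α z hx, norm_zero]; positivity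
  · rw [mlDiffExt_of_nonneg a b α z hx.le, abs_of_pos hx, Real.norm_of_nonneg (by positivity)]
    have h1 := hC x (by simpa using hx.le)
    simp only [ofReal_im, abs_zero, mul_zero, neg_zero, Real.exp_zero, mul_one, norm_real,
      Real.norm_of_nonneg hx.le] at h1
    refine h1.trans ?_
    have h2 := Real.quadratic_le_exp_of_nonneg (x := δ * x) (by positivity)
    have h3 : (δ * x) ^ 2 / 2 ≤ Real.exp (δ * x) := by
      have : 0 ≤ δ * x := by positivity
      linarith
    rw [Real.exp_neg, Real.rpow_neg hx.le, Real.rpow_two, mul_assoc]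
    gcongr
    calc (Real.exp (δ * x))⁻¹ ≤ ((δ * x) ^ 2 / 2)⁻¹ := by gcongr
      _ = _ := by field_simp

lemma fourier_mlDiffExt (a b α : ℝ) (z : ℂ) (k : ℤ) :
    𝓕 (mlDiffExt a b α z) k =
      ∫ x in Set.Ioi (0 : ℝ), exp (-2 * Real.pi * I * k * x) * mlDiff a b α z x := by
  rw [Real.fourier_real_eq_integral_exp_smul, ← MeasureTheory.integral_indicator measurableSet_Ioi]
  congr 1 with x
  rcases le_or_gt x 0 with hx | hx
  · rw [mlDiffExt_of_nonpos a b α z hx, Set.indicator_of_notMem (by simpa using hx), smul_zero]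
  · rw [mlDiffExt_of_nonneg a b α z hx.le, Set.indicator_of_mem (by exact hx), smul_eq_mul]
    congr 2
    push_cast
    ring

lemma integral_mlDiff {a b α : ℝ} (ha : 0 < a) (hb : 0 < b) (hα : 0 < α) (z : ℂ) :
    ∫ x in Set.Ioi (0 : ℝ), mlDiff a b α z x =
      (∫ x in Set.Ioi (0 : ℝ), mlInterp a b α z x) - mlCoeff a b α 0 := by
  have h1 : MeasureTheory.IntegrableOn (fun x : ℝ => exp (-x)) (Set.Ioi 0) := by
    have := (integrableOn_exp_neg_Ioi 0).ofReal (𝕜 := ℂ)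
    refine this.congr (Eventually.of_forall fun x => ?_)
    simp
  have h2 : ∫ x in Set.Ioi (0 : ℝ), exp (-x) = 1 := by
    have := integral_exp_neg_Ioi_zero
    have h3 := congrArg ((↑) : ℝ → ℂ) this
    rw [← integral_complex_ofReal] at h3
    simpa using h3
  simp only [mlDiff]
  rw [MeasureTheory.integral_sub (integrableOn_mlInterp ha hb hα z) (h1.const_mul _),
    MeasureTheory.integral_const_mul, h2, mul_one]

lemma tsum_mlDiffExt {a b α : ℝ} (ha : 0 < a) (hb : 0 < b) (hα : 0 < α) {z : ℂ} (hz : z ≠ 0) :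
    ∑' n : ℤ, mlDiffExt a b α z n =
      mlF a b α z - mlCoeff a b α 0 * ∑' n : ℕ, exp (-n) := by
  have hinj : Function.Injective ((↑) : ℕ → ℤ) := Nat.cast_injective
  rw [← hinj.tsum_eq (f := fun n : ℤ => mlDiffExt a b α z n)]
  · have h1 : Summable fun n : ℕ => exp (-(n : ℂ)) := by
      refine (ofRealCLM.summable (summable_exp_neg_mul_nat one_pos)).congr fun n => ?_
      simp
    rw [mlF_eq_tsum_mlInterp ha hb hz, ← tsum_mul_left,
      ← (summable_mlInterp ha hb hα z).tsum_sub (h1.mul_left _)]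
    refine tsum_congr fun n => ?_
    rw [mlDiffExt_of_nonneg a b α z (by positivity), mlDiff]
    simp
  · intro n hn
    rcases le_or_gt n 0 with h | h
    · exact absurd (mlDiffExt_of_nonpos a b α z (by exact_mod_cast h)) hn
    · exact ⟨n.toNat, by simpa using h.le⟩

/-- The Mittag-Leffler series differs from the corresponding integral by `O(1 + log |z|)`. -/
theorem exists_norm_mlF_sub_integral_le {a b α : ℝ} (ha : 0 < a) (hb : 0 < b) (hα : 0 < α)
    {ε : ℝ} (hε : 0 < ε) :
    ∃ C, ∀ z : ℂ, 1 ≤ ‖z‖ → Real.pi * (a * α) / 2 + |arg z| ≤ 2 * Real.pi - ε →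
      ‖mlF a b α z - ∫ x in Set.Ioi (0 : ℝ), mlInterp a b α z x‖ ≤ C * (1 + Real.log ‖z‖) := by
  obtain ⟨C, hC0, hC⟩ := exists_norm_integral_mlDiff_le ha hb hα hε
  -- S is the cost, independent of z, of having subtracted f(0)e^(-s): its sum minus its integral.
  -- The other summand uses 1/0² = 0 at k = 0, where the coefficient is treated separately.
  set S := ‖mlCoeff a b α 0 * ∑' n : ℕ, exp (-(n : ℂ)) - mlCoeff a b α 0‖
  refine ⟨S + C * ∑' k : ℤ, 1 / (k : ℝ) ^ 2, fun z hz hzε => ?_⟩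
  have hlog : 0 ≤ Real.log ‖z‖ := Real.log_nonneg hz
  have hz0 : z ≠ 0 := by rintro rfl; norm_num at hz
  have hsum : Summable fun k : ℤ => 1 / (k : ℝ) ^ 2 := Real.summable_one_div_int_pow.2 one_lt_two
  have hk : ∀ k : ℤ, k ≠ 0 → ‖𝓕 (mlDiffExt a b α z) k‖ ≤
      C * (1 + Real.log ‖z‖) * (1 / (k : ℝ) ^ 2) := fun k hk => by
    have hk0 : (k : ℝ) ≠ 0 := by exact_mod_cast hk
    have h1 : (1 : ℝ) ≤ |(k : ℝ)| := by exact_mod_cast Int.one_le_abs hk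
    have h2 := hC z hz hzε (k / |(k : ℝ)|) (by rw [abs_div, abs_abs, div_self (by positivity)])
      |(k : ℝ)| h1
    rw [sq_abs] at h2
    rw [fourier_mlDiffExt]
    have h3 : (((k / |(k : ℝ)| : ℝ) : ℂ) * ((|(k : ℝ)| : ℝ) : ℂ)) = k := by
      rw [← ofReal_mul, div_mul_cancel₀ _ (by positivity)]; simp
    rwa [h3] at h2
  have hite : ∀ k : ℤ, ‖ite (k = 0) 0 (𝓕 (mlDiffExt a b α z) k)‖ ≤
      C * (1 + Real.log ‖z‖) * (1 / (k : ℝ) ^ 2) := fun k => by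
    split_ifs with h
    · rw [norm_zero]; positivity
    · exact hk k h
  have hs1 : Summable fun k : ℤ => ite (k = 0) 0 (𝓕 (mlDiffExt a b α z) k) :=
    Summable.of_norm_bounded (hsum.mul_left _) hite
  have hF : Summable fun k : ℤ => 𝓕 (mlDiffExt a b α z) k := by
    refine (summable_congr_cofinite ?_).1 hs1
    filter_upwards [(Set.finite_singleton (0 : ℤ)).compl_mem_cofinite] with k hk
    exact if_neg hk
  have hP := Real.tsum_eq_tsum_fourier_of_rpow_decay_of_summable (continuous_mlDiffExt ha hb α z)
    one_lt_two (isBigO_mlDiffExt ha hb hα hε hzε) hF 0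
  simp only [zero_add, QuotientAddGroup.mk_zero, fourier_eval_zero, mul_one] at hP
  rw [tsum_mlDiffExt ha hb hα hz0, hF.tsum_eq_add_tsum_ite 0] at hP
  have h0 : 𝓕 (mlDiffExt a b α z) (0 : ℤ) =
      (∫ x in Set.Ioi (0 : ℝ), mlInterp a b α z x) - mlCoeff a b α 0 := by
    rw [fourier_mlDiffExt, ← integral_mlDiff ha hb hα]
    simp
  rw [h0] at hP
  have e : mlF a b α z - ∫ x in Set.Ioi (0 : ℝ), mlInterp a b α z x =
      (mlCoeff a b α 0 * ∑' n : ℕ, exp (-(n : ℂ)) - mlCoeff a b α 0) +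
        ∑' k : ℤ, ite (k = 0) 0 (𝓕 (mlDiffExt a b α z) k) := by
    linear_combination hP
  rw [e]
  refine (norm_add_le _ _).trans ?_
  have h5 := tsum_of_norm_bounded (hsum.mul_left (C * (1 + Real.log ‖z‖))).hasSum hite
  rw [tsum_mul_left] at h5
  have h6 : S * 1 ≤ S * (1 + Real.log ‖z‖) := by gcongr; linarith
  calc _ ≤ S + C * (1 + Real.log ‖z‖) * ∑' k : ℤ, 1 / (k : ℝ) ^ 2 := add_le_add le_rfl h5
    _ ≤ _ := by linarith

/-! ### The saddle point method -/

/-- The phase function of the saddle point integral, with minimum at `1`. -/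
noncomputable def phase (x : ℝ) : ℝ := x * Real.log x - x + 1

/-- From log √x ≥ 1 - 1/√x the phase is at least (√x - 1)², and (√x + 1)² ≤ 2(x + 1). The bound is
quadratic near 1 and linear at infinity. -/
lemma sq_div_le_phase {x : ℝ} (hx : 0 ≤ x) : (x - 1) ^ 2 / (2 * (x + 1)) ≤ phase x := by
  have h1 : (√x - 1) ^ 2 ≤ phase x := by
    rcases hx.eq_or_lt with rfl | hx
    · simp [phase]
    · have hs : 0 < √x := Real.sqrt_pos.2 hx
      have h2 := Real.one_sub_inv_le_log_of_pos hs
      have h3 : Real.log x = 2 * Real.log √x := by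
        rw [Real.log_sqrt hx.le]; ring
      have h4 : √x * √x = x := Real.mul_self_sqrt hx.le
      have h5 : √x * √x * (1 - (√x)⁻¹) ≤ √x * √x * Real.log √x := by gcongr
      have h6 : √x * √x * (1 - (√x)⁻¹) = √x * √x - √x := by field_simp
      rw [phase, h3]
      nlinarith
  refine le_trans ?_ h1
  have hs : 0 ≤ √x := Real.sqrt_nonneg x
  have h4 : √x * √x = x := Real.mul_self_sqrt hx
  rw [div_le_iff₀ (by positivity)]
  have : (x - 1) ^ 2 = (√x - 1) ^ 2 * (√x + 1) ^ 2 := by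
    rw [← mul_pow]; congr 1; linarith
  rw [this]
  gcongr
  nlinarith [sq_nonneg (√x - 1)]

/-- The normalized integrand of the saddle point integral. -/
noncomputable def saddleIntegrand (b α : ℝ) (w : ℂ) (x : ℝ) : ℂ :=
  exp ((α * (b - 1 / 2) : ℝ) * log w) * gammaQuot b α (w * x) * exp (-α * w * phase x)

/-- The sector of all `w` with `κ |w| ≤ Re w`. -/
def reSector (κ : ℝ) : Set ℂ := {w | κ * ‖w‖ ≤ w.re}

lemma norm_exp_ofReal_mul_log (p : ℝ) {w : ℂ} (hw : w ≠ 0) : ‖exp (p * log w)‖ = ‖w‖ ^ p := by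
  rw [norm_exp, re_ofReal_mul, log_re, Real.rpow_def_of_pos (norm_pos_iff.2 hw), mul_comm]

/-- This is the majorant for dominated convergence in the variable t = √|w|(x - 1). Exponential
rather than Gaussian decay is all that survives for large x, where the phase bound is linear. -/
lemma exists_norm_saddleIntegrand_le {b α κ : ℝ} (hb : 0 < b) (hα : 0 < α) (hκ : 0 < κ) :
    ∃ C β, 0 < C ∧ 0 < β ∧ ∀ w ∈ reSector κ, 1 ≤ ‖w‖ → ∀ x : ℝ, 0 ≤ x →
      ‖saddleIntegrand b α w x‖ ≤ C * Real.exp (-(β * (√‖w‖ * |x - 1|))) := by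
  obtain ⟨C, hC, h⟩ := exists_norm_gammaQuot_le hb hα
  set m := α * (b - 1 / 2) with hm
  set γ := α * κ with hγ
  have hγ0 : 0 < γ := by positivity
  obtain ⟨D, hD, h'⟩ := exists_one_add_rpow_le_exp |m| (show 0 < γ / 32 by positivity)
  refine ⟨C * ((4 : ℝ) ^ |m| * D) * Real.exp γ, γ / 32, by positivity, by positivity,
    fun w hw hR x hx => ?_⟩
  have hw : κ * ‖w‖ ≤ w.re := hw
  have hw0 : w ≠ 0 := by rintro rfl; norm_num at hR
  set R := ‖w‖ with hRdef
  have hR0 : 0 < R := by linarith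
  have hre : 0 ≤ w.re := le_trans (by positivity) hw
  set τ := √R * |x - 1| with hτ
  have hsR : 1 ≤ √R := Real.one_le_sqrt.2 hR
  have hsR2 : √R * √R = R := Real.mul_self_sqrt hR0.le
  have hτ0 : 0 ≤ τ := by positivity
  have hτ2 : τ ^ 2 = R * (x - 1) ^ 2 := by rw [hτ, mul_pow, sq_abs, sq, hsR2]
  have hτ1 : |x - 1| ≤ τ := le_mul_of_one_le_left (abs_nonneg _) hsR
  have hph := sq_div_le_phase hx
  have hnwx : ‖w * (x : ℂ)‖ = R * x := by rw [norm_mul, norm_real, Real.norm_of_nonneg hx]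
  have h1 : ‖saddleIntegrand b α w x‖ ≤
      C * ((R / (1 + R * x)) ^ m * Real.exp (-(γ * (R * phase x)))) := by
    rw [saddleIntegrand, norm_mul, norm_mul, norm_exp_ofReal_mul_log _ hw0]
    have e1 := h (w * x) (by rw [mul_comm, re_ofReal_mul]; positivity)
    rw [hnwx] at e1
    have e2 : ‖exp (-α * w * phase x)‖ ≤ Real.exp (-(γ * (R * phase x))) := by
      rw [norm_exp, Real.exp_le_exp]
      have e3 : (-α * w * phase x : ℂ).re = -(α * w.re * phase x) := by
        rw [show (-α * w * phase x : ℂ) = ((-(α * phase x) : ℝ) : ℂ) * w by push_cast; ring,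
          re_ofReal_mul]
        ring
      rw [e3, hγ]
      have : 0 ≤ phase x := le_trans (by positivity) hph
      have : α * (κ * R) * phase x ≤ α * w.re * phase x := by gcongr
      linarith
    rw [Real.div_rpow hR0.le (by positivity)]
    calc _ ≤ R ^ m * (C * (1 + R * x) ^ (-m)) * Real.exp (-(γ * (R * phase x))) := by gcongr
      _ = _ := by rw [Real.rpow_neg (by positivity)]; ring
  have h2 : ∀ A y : ℝ, 0 ≤ y → A⁻¹ ≤ R / (1 + R * x) → R / (1 + R * x) ≤ A → 0 < A →
      A ≤ 4 * (1 + y) →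
      (R / (1 + R * x)) ^ m ≤ (4 : ℝ) ^ |m| * D * Real.exp (γ / 32 * y) :=
      fun A y hy hA1 hA2 hA hAy => by
    calc _ ≤ A ^ |m| := rpow_le_rpow_abs hA hA1 hA2 m
      _ ≤ (4 * (1 + y)) ^ |m| := by gcongr
      _ = (4 : ℝ) ^ |m| * (1 + y) ^ |m| := Real.mul_rpow (by norm_num) (by positivity)
      _ ≤ (4 : ℝ) ^ |m| * (D * Real.exp (γ / 32 * y)) := by gcongr; exact h' y hy
      _ = _ := by ring
  have h3 : ∀ y : ℝ, (R / (1 + R * x)) ^ m ≤ (4 : ℝ) ^ |m| * D * Real.exp (γ / 32 * y) →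
      γ / 32 * y - γ * (R * phase x) ≤ γ - γ / 32 * τ →
      ‖saddleIntegrand b α w x‖ ≤
        C * ((4 : ℝ) ^ |m| * D) * Real.exp γ * Real.exp (-(γ / 32 * τ)) := fun y hy1 hy2 => by
    calc _ ≤ _ := h1
      _ ≤ C * ((4 : ℝ) ^ |m| * D * Real.exp (γ / 32 * y) * Real.exp (-(γ * (R * phase x)))) := by
        gcongr
      _ = C * ((4 : ℝ) ^ |m| * D) * Real.exp (γ / 32 * y - γ * (R * phase x)) := by
        rw [sub_eq_add_neg, Real.exp_add]; ring
      _ ≤ C * ((4 : ℝ) ^ |m| * D) * Real.exp (γ - γ / 32 * τ) := by gcongr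
      _ = _ := by rw [sub_eq_add_neg γ, Real.exp_add]; ring
  -- For x ≥ 1/2 the power factor is polynomial in τ and R·phase ≥ (τ-1)/4. For x < 1/2 the power
  -- may be as large as a power of R, but phase ≥ 1/16 gives decay in R ≥ τ.
  rcases le_or_gt (1 / 2) x with hx2 | hx2
  · have hxτ : x ≤ 1 + τ := by linarith [le_abs_self (x - 1)]
    refine h3 τ (h2 (2 * (1 + x)) τ hτ0 ?_ ?_ (by positivity) (by linarith)) ?_
    · rw [inv_eq_one_div, div_le_div_iff₀ (by positivity) (by positivity)]
      nlinarith [mul_nonneg hR0.le hx]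
    · rw [div_le_iff₀ (by positivity)]
      nlinarith [mul_nonneg hR0.le hx]
    · have e1 : (τ - 1) / 4 ≤ R * phase x := by
        calc (τ - 1) / 4 ≤ τ ^ 2 / (2 * (x + 1)) := by
              rw [le_div_iff₀ (by positivity)]
              rcases le_or_gt τ 1 with h | h
              · nlinarith [mul_nonneg (sub_nonneg.2 h) hx, sq_nonneg τ]
              · nlinarith [mul_nonneg (sub_nonneg.2 h.le) (sub_nonneg.2 hxτ)]
          _ = R * ((x - 1) ^ 2 / (2 * (x + 1))) := by rw [hτ2]; ring
          _ ≤ _ := by gcongr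
      have e2 : γ * ((τ - 1) / 4) ≤ γ * (R * phase x) := by gcongr
      have e3 : 0 ≤ γ * τ := by positivity
      linarith
  · have hxa : |x - 1| ≤ 1 := by rw [abs_le]; constructor <;> linarith
    have hτR : τ ≤ R := by
      calc τ ≤ √R * 1 := mul_le_mul_of_nonneg_left hxa (Real.sqrt_nonneg R)
        _ ≤ √R * √R := by gcongr
        _ = R := hsR2
    refine h3 R (h2 (2 * R) R hR0.le ?_ ?_ (by positivity) (by linarith)) ?_
    · rw [inv_eq_one_div, div_le_div_iff₀ (by positivity) (by positivity)]
      nlinarith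
    · rw [div_le_iff₀ (by positivity)]
      nlinarith [mul_nonneg hR0.le hx]
    · have e1 : 1 / 16 ≤ phase x := by
        refine le_trans ?_ hph
        rw [le_div_iff₀ (by positivity)]
        nlinarith
      have e2 : γ * (R * (1 / 16)) ≤ γ * (R * phase x) := by gcongr
      have e3 : γ * τ ≤ γ * R := by gcongr
      linarith

lemma abs_phase_one_add_sub_le {v : ℝ} (hv : |v| ≤ 1 / 2) :
    |phase (1 + v) - v ^ 2 / 2| ≤ 4 * |v| ^ 3 := by
  have h := Real.abs_log_sub_add_sum_range_le (x := -v) (by rw [abs_neg]; linarith) 2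
  rw [abs_neg, sub_neg_eq_add] at h
  simp only [Finset.sum_range_succ, Finset.sum_range_zero] at h
  norm_num at h
  set e := -v + v ^ 2 / 2 + Real.log (1 + v) with he
  have h1 : |e| ≤ 2 * |v| ^ 3 := by
    refine h.trans ?_
    rw [div_le_iff₀ (by linarith)]
    nlinarith [pow_nonneg (abs_nonneg v) 3]
  have h2 : phase (1 + v) - v ^ 2 / 2 = (1 + v) * e - v ^ 3 / 2 := by
    rw [phase, he]; ring
  rw [h2]
  have h3 : |1 + v| ≤ 3 / 2 := by
    rw [abs_le] at hv ⊢; constructor <;> linarith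
  calc _ ≤ |(1 + v) * e| + |v ^ 3 / 2| := abs_sub _ _
    _ = |1 + v| * |e| + |v| ^ 3 / 2 := by
      rw [abs_mul, abs_div, abs_pow, abs_of_pos (two_pos : (0 : ℝ) < 2)]
    _ ≤ 3 / 2 * (2 * |v| ^ 3) + |v| ^ 3 / 2 := by gcongr
    _ ≤ _ := by nlinarith [pow_nonneg (abs_nonneg v) 3]

/-- The cubic Taylor error is R|ξ-1|³ = (√R(ξ-1))²|ξ-1|, a bounded factor times one tending to 0. -/
lemma tendsto_mul_phase {ι : Type*} {l : Filter ι} {R ξ : ι → ℝ} {t : ℝ}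
    (hR : Tendsto R l atTop) (hξ : Tendsto (fun i => √(R i) * (ξ i - 1)) l (𝓝 t)) :
    Tendsto ξ l (𝓝 1) ∧ Tendsto (fun i => R i * phase (ξ i)) l (𝓝 (t ^ 2 / 2)) := by
  have hs : Tendsto (fun i => √(R i)) l atTop := Real.tendsto_sqrt_atTop.comp hR
  have hv : Tendsto (fun i => ξ i - 1) l (𝓝 0) := by
    have := hs.inv_tendsto_atTop.mul hξ
    rw [zero_mul] at this
    refine this.congr' ?_
    filter_upwards [hs.eventually_gt_atTop 0] with i hi
    simp only [Pi.inv_apply]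
    field_simp
  have h1 : Tendsto ξ l (𝓝 1) := by simpa using hv.add_const 1
  refine ⟨h1, ?_⟩
  have h2 := (hξ.pow 2).div_const 2
  refine h2.congr_dist ?_
  have h3 := ((hξ.pow 2).mul hv.abs).const_mul 4
  rw [abs_zero, mul_zero, mul_zero] at h3
  refine squeeze_zero' (Eventually.of_forall fun _ => dist_nonneg) ?_ h3
  have habs : Tendsto (fun i => |ξ i - 1|) l (𝓝 0) := by simpa using hv.abs
  filter_upwards [hR.eventually_ge_atTop 0,
    habs.eventually_le_const (show (0 : ℝ) < 1 / 2 by norm_num)] with i hRi hi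
  have h4 := abs_phase_one_add_sub_le hi
  rw [add_sub_cancel] at h4
  have h5 : (√(R i) * (ξ i - 1)) ^ 2 = R i * (ξ i - 1) ^ 2 := by
    rw [mul_pow, Real.sq_sqrt hRi]
  rw [dist_comm, Real.dist_eq, h5]
  calc _ = R i * |phase (ξ i) - (ξ i - 1) ^ 2 / 2| := by
        rw [← abs_of_nonneg hRi, ← abs_mul, abs_of_nonneg hRi]; congr 1; ring
    _ ≤ R i * (4 * |ξ i - 1| ^ 3) := by gcongr
    _ = _ := by rw [← sq_abs (ξ i - 1)]; ring

/-- The Gaussian approximating the integrand near the saddle point. -/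
noncomputable def saddleGaussian (α : ℝ) (w : ℂ) (t : ℝ) : ℂ :=
  exp (-α * (Real.log (2 * Real.pi) / 2 : ℝ)) * exp (-(α / 2 * (w / ‖w‖)) * t ^ 2)

lemma le_re_div_norm {κ : ℝ} {w : ℂ} (hw : w ∈ reSector κ) (h0 : w ≠ 0) :
    κ ≤ (w / ‖w‖).re := by
  rw [div_ofReal_re, le_div_iff₀ (norm_pos_iff.2 h0)]; exact hw

lemma norm_gaussian_le {α κ : ℝ} (hα : 0 < α) {w : ℂ} (hw : w ∈ reSector κ) (h0 : w ≠ 0) (t : ℝ) :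
    ‖exp (-(α / 2 * (w / ‖w‖)) * t ^ 2)‖ ≤ Real.exp (-(α * κ / 2) * t ^ 2) := by
  rw [norm_exp, Real.exp_le_exp]
  have : (-(α / 2 * (w / ‖w‖)) * t ^ 2 : ℂ).re = -(α * (w / ‖w‖).re / 2) * t ^ 2 := by
    rw [show (-(α / 2 * (w / ‖w‖)) * t ^ 2 : ℂ) =
      ((-(α / 2) * t ^ 2 : ℝ) : ℂ) * (w / ‖w‖) by push_cast; ring, re_ofReal_mul]
    ring
  rw [this]
  have h1 := le_re_div_norm hw h0
  have h2 : α * κ / 2 ≤ α * (w / ‖w‖).re / 2 := by gcongr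
  nlinarith [sq_nonneg t]

/-- A difference is used instead of a limit because the direction w/|w|, on which the Gaussian
depends, need not converge. After factoring out the Gaussian, of modulus at most 1, the rest has a
limit. The general ξ leaves room for perturbed points. -/
lemma tendsto_saddleIntegrand_sub {b α κ : ℝ} (hb : 0 < b) (hα : 0 < α) (hκ : 0 < κ)
    {ξ : ℂ → ℝ} {t : ℝ}
    (hξ : Tendsto (fun w => √‖w‖ * (ξ w - 1)) (cobounded ℂ ⊓ 𝓟 (reSector κ)) (𝓝 t)) :
    Tendsto (fun w => saddleIntegrand b α w (ξ w) - saddleGaussian α w t)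
      (cobounded ℂ ⊓ 𝓟 (reSector κ)) (𝓝 0) := by
  set l := cobounded ℂ ⊓ 𝓟 (reSector κ)
  have hR : Tendsto (fun w : ℂ => ‖w‖) l atTop := tendsto_norm_cobounded_atTop.mono_left inf_le_left
  obtain ⟨h1, h2⟩ := tendsto_mul_phase hR hξ
  have hmem : ∀ᶠ w in l, w ∈ reSector κ := mem_inf_of_right (mem_principal_self _)
  have hne : ∀ᶠ w in l, w ≠ 0 := mem_inf_of_left (eventually_ne_cobounded 0)
  have hre : ∀ᶠ w in l, 0 < w.re := by
    filter_upwards [hmem, hne] with w h3 h4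
    have h3 : κ * ‖w‖ ≤ w.re := h3
    have := norm_pos_iff.2 h4
    exact lt_of_lt_of_le (by positivity) h3
  have hξpos : ∀ᶠ w in l, 0 < ξ w := h1.eventually_const_lt one_pos
  have hu : Tendsto (fun w => w * ξ w) l (cobounded ℂ ⊓ 𝓟 {u | 0 < u.re}) := by
    refine tendsto_inf.2 ⟨?_, tendsto_principal.2 ?_⟩
    · rw [← tendsto_norm_atTop_iff_cobounded]
      refine (hR.atTop_mul_pos one_pos (show Tendsto (fun w => |ξ w|) l (𝓝 1) by
        simpa using h1.abs)).congr fun w => ?_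
      rw [norm_mul, norm_real, Real.norm_eq_abs]
    · filter_upwards [hre, hξpos] with w h3 h4
      show 0 < (w * ξ w : ℂ).re
      rw [mul_comm, re_ofReal_mul]; positivity
  have hP := (tendsto_gammaQuot hb α).comp hu
  have hlog : Tendsto (fun w => exp (-((α * (b - 1 / 2) : ℝ) * (Real.log (ξ w) : ℂ)))) l (𝓝 1) := by
    have h3 : Tendsto (fun w => Real.log (ξ w)) l (𝓝 0) := by
      simpa using h1.log one_ne_zero
    have h4 := (((continuous_ofReal.tendsto _).comp h3).const_mul
      ((α * (b - 1 / 2) : ℝ) : ℂ)).neg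
    simp only [ofReal_zero, mul_zero, neg_zero] at h4
    have h5 := (continuous_exp.tendsto _).comp h4
    rw [exp_zero] at h5
    exact h5
  have hsmall : Tendsto (fun w => exp (-(α * (w / ‖w‖)) *
      ((‖w‖ * phase (ξ w) - t ^ 2 / 2 : ℝ) : ℂ))) l (𝓝 1) := by
    have h3 : Tendsto (fun w => -(α * (w / ‖w‖)) *
        ((‖w‖ * phase (ξ w) - t ^ 2 / 2 : ℝ) : ℂ)) l (𝓝 0) := by
      have h4 := (h2.sub_const (t ^ 2 / 2)).norm.const_mul α
      rw [sub_self, norm_zero, mul_zero] at h4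
      refine squeeze_zero_norm' ?_ h4
      filter_upwards [hne] with w h5
      have : ‖w / (‖w‖ : ℂ)‖ = 1 := by
        rw [norm_div, norm_real, norm_norm, div_self (norm_ne_zero_iff.2 h5)]
      rw [norm_mul, norm_neg, norm_mul, this, mul_one, norm_real, norm_real,
        Real.norm_of_nonneg hα.le]
    have h5 := (continuous_exp.tendsto _).comp h3
    rw [exp_zero] at h5
    exact h5
  have hall := ((hP.mul hlog).mul hsmall).sub_const
    (exp (-α * (Real.log (2 * Real.pi) / 2 : ℝ)))
  rw [mul_one, mul_one, sub_self] at hall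
  have hn := hall.norm
  rw [norm_zero] at hn
  refine squeeze_zero_norm' ?_ hn
  filter_upwards [hmem, hne, hre, hξpos] with w h3 h4 h5 h6
  have hlogw : log (w * ξ w) = log w + Real.log (ξ w) := by
    rw [log_mul_ofReal _ h6 _ h4, add_comm]
  have hRne : (‖w‖ : ℂ) ≠ 0 := by exact_mod_cast norm_ne_zero_iff.2 h4
  have e : saddleIntegrand b α w (ξ w) - saddleGaussian α w t =
      (exp (α * (b - 1 / 2) * log (w * ξ w)) * gammaQuot b α (w * ξ w) *
        exp (-((α * (b - 1 / 2) : ℝ) * (Real.log (ξ w) : ℂ))) *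
        exp (-(α * (w / ‖w‖)) * ((‖w‖ * phase (ξ w) - t ^ 2 / 2 : ℝ) : ℂ)) -
          exp (-α * (Real.log (2 * Real.pi) / 2 : ℝ))) * exp (-(α / 2 * (w / ‖w‖)) * t ^ 2) := by
    rw [saddleIntegrand, saddleGaussian, sub_mul]
    congr 1
    have e1 : exp ((α * (b - 1 / 2) : ℝ) * log w) = exp (α * (b - 1 / 2) * log (w * ξ w)) *
        exp (-((α * (b - 1 / 2) : ℝ) * (Real.log (ξ w) : ℂ))) := by
      rw [← exp_add, hlogw]
      congr 1
      push_cast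
      ring
    have e2 : exp (-α * w * phase (ξ w)) =
        exp (-(α * (w / ‖w‖)) * ((‖w‖ * phase (ξ w) - t ^ 2 / 2 : ℝ) : ℂ)) *
        exp (-(α / 2 * (w / ‖w‖)) * t ^ 2) := by
      rw [← exp_add]
      congr 1
      push_cast
      field_simp
      ring
    rw [e1, e2]
    ring
  rw [e, norm_mul]
  refine mul_le_of_le_one_right (norm_nonneg _) ((norm_gaussian_le hα h3 h4 t).trans ?_)
  rw [Real.exp_le_one_iff]
  have : 0 ≤ α * κ / 2 := by positivity
  nlinarith [sq_nonneg t]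

/-- The Gaussian integral is proportional to (|w|/w)^(1/2), and the prefactor cancels exactly this
direction, leaving a constant. -/
lemma integral_saddleGaussian {α κ : ℝ} (hα : 0 < α) (hκ : 0 < κ) {w : ℂ} (hw : w ∈ reSector κ)
    (h0 : w ≠ 0) : exp (log w / 2) / (√‖w‖ : ℝ) * ∫ t : ℝ, saddleGaussian α w t =
      exp (-α * (Real.log (2 * Real.pi) / 2 : ℝ)) * (√(2 * Real.pi / α) : ℝ) := by
  have hR : 0 < ‖w‖ := norm_pos_iff.2 h0
  have hre : 0 < w.re := lt_of_lt_of_le (by positivity) (show κ * ‖w‖ ≤ w.re from hw)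
  have hRne : (‖w‖ : ℂ) ≠ 0 := by exact_mod_cast hR.ne'
  simp only [saddleGaussian]
  rw [MeasureTheory.integral_const_mul, integral_gaussian_complex]
  · have e1 : (Real.pi / (α / 2 * (w / ‖w‖)) : ℂ) =
        ((2 * Real.pi / α * ‖w‖ : ℝ) : ℂ) * w⁻¹ := by
      have : (α : ℂ) ≠ 0 := by exact_mod_cast hα.ne'
      push_cast
      field_simp
    have hq : 0 < 2 * Real.pi / α * ‖w‖ := by have := Real.pi_pos; positivity
    have e2 : log (((2 * Real.pi / α * ‖w‖ : ℝ) : ℂ) * w⁻¹) =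
        Real.log (2 * Real.pi / α * ‖w‖) - log w := by
      rw [log_ofReal_mul hq (inv_ne_zero h0), log_inv _ (slitPlane_arg_ne_pi (Or.inl hre))]
      ring
    have e3 : (((2 * Real.pi / α * ‖w‖ : ℝ) : ℂ) * w⁻¹) ^ (1 / 2 : ℂ) =
        (√(2 * Real.pi / α) * √‖w‖ : ℝ) * exp (-(log w / 2)) := by
      have hq' : (((2 * Real.pi / α * ‖w‖ : ℝ) : ℂ) * w⁻¹) ≠ 0 :=
        mul_ne_zero (by exact_mod_cast hq.ne') (inv_ne_zero h0)
      rw [cpow_def_of_ne_zero hq', e2, ← Real.sqrt_mul (by have := Real.pi_pos; positivity),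
        Real.sqrt_eq_rpow, Real.rpow_def_of_pos hq, ofReal_exp, ← exp_add]
      congr 1
      push_cast
      ring
    rw [e1, e3, exp_neg]
    have : ((√‖w‖ : ℝ) : ℂ) ≠ 0 := by exact_mod_cast (Real.sqrt_pos.2 hR).ne'
    have h2 := exp_ne_zero (log w / 2)
    push_cast
    field_simp
  · rw [show (α / 2 * (w / ‖w‖) : ℂ) = ((α / 2 : ℝ) : ℂ) * (w / ‖w‖) by push_cast; ring,
      re_ofReal_mul]
    have := hκ.trans_le (le_re_div_norm hw h0)
    positivity

lemma continuousOn_saddleIntegrand {b : ℝ} (hb : 0 < b) (α : ℝ) {w : ℂ} (hw : 0 < w.re) :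
    ContinuousOn (saddleIntegrand b α w) (Set.Ioi 0) := by
  have hre : ∀ x ∈ Set.Ioi (0 : ℝ), 0 < (w * x : ℂ).re := fun x hx => by
    have hx : 0 < x := hx
    rw [mul_comm, re_ofReal_mul]; positivity
  have h1 : ContinuousOn (fun x : ℝ => logGamma (w * x + b)) (Set.Ioi 0) := by
    refine differentiableOn_logGamma.continuousOn.comp (by fun_prop) fun x hx => ?_
    show 0 < (w * x + b : ℂ).re
    rw [add_re, ofReal_re]
    linarith [hre x hx]
  have h2 : ContinuousOn (fun x : ℝ => log (w * x)) (Set.Ioi 0) :=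
    ContinuousOn.clog (by fun_prop) fun x hx => Or.inl (hre x hx)
  have h3 : ContinuousOn (fun x : ℝ => ((phase x : ℝ) : ℂ)) (Set.Ioi 0) := by
    refine continuous_ofReal.comp_continuousOn ?_
    unfold phase
    exact ((continuousOn_id.mul (Real.continuousOn_log.mono fun x hx => ne_of_gt hx)).sub
      continuousOn_id).add continuousOn_const
  unfold saddleIntegrand gammaQuot
  fun_prop

/-- Continuity is known only on x > 0, whereas the floor makes X take the value 0; the value there
is patched in separately. -/
lemma measurable_saddleIntegrand_comp {b : ℝ} (hb : 0 < b) (α : ℝ) {w : ℂ} (hw : 0 < w.re)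
    {X : ℝ → ℝ} (hX : Measurable X) (hX0 : ∀ x, 0 < x → 0 ≤ X x) :
    Measurable ((Set.Ioi (0 : ℝ)).indicator fun x => saddleIntegrand b α w (X x)) := by
  classical
  have h1 : Measurable ((Set.Ioi (0 : ℝ)).piecewise (saddleIntegrand b α w)
      (fun _ => saddleIntegrand b α w 0)) :=
    (continuousOn_saddleIntegrand hb α hw).measurable_piecewise continuousOn_const
      measurableSet_Ioi
  have h2 := (h1.comp hX).indicator (measurableSet_Ioi (a := (0 : ℝ)))
  convert! h2 using 1
  ext x
  rcases le_or_gt x 0 with hx | hx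
  · rw [Set.indicator_of_notMem (by simpa using hx), Set.indicator_of_notMem (by simpa using hx)]
  · rw [Set.indicator_of_mem (by exact hx), Set.indicator_of_mem (by exact hx),
      Function.comp_apply]
    rcases (hX0 x hx).eq_or_lt with h | h
    · rw [← h, Set.piecewise_eq_of_notMem _ _ _ (by simp)]
    · rw [Set.piecewise_eq_of_mem _ _ _ (by exact h)]

lemma integrable_exp_neg_mul_abs {β : ℝ} (hβ : 0 < β) :
    MeasureTheory.Integrable fun t : ℝ => Real.exp (-(β * |t|)) := by
  rw [← MeasureTheory.integrableOn_univ, ← Set.Iic_union_Ioi (a := (0 : ℝ))]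
  refine MeasureTheory.IntegrableOn.union ?_ ?_
  · refine (integrableOn_exp_mul_Iic hβ 0).congr_fun (fun t ht => ?_) measurableSet_Iic
    simp only
    rw [abs_of_nonpos ht]; congr 1; ring
  · refine (integrableOn_exp_mul_Ioi (neg_lt_zero.2 hβ) 0).congr_fun (fun t ht => ?_)
      measurableSet_Ioi
    simp only
    rw [abs_of_pos ht]; congr 1; ring

/-- The saddle point asymptotics. The points at which the integrand is evaluated may be perturbed
by `O(1 / |w|)`. -/
theorem tendsto_integral_saddleIntegrand {b α κ K : ℝ} (hb : 0 < b) (hα : 0 < α) (hκ : 0 < κ)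
    {X : ℂ → ℝ → ℝ} (hXm : ∀ w, Measurable (X w)) (hX0 : ∀ w x, 0 < x → 0 ≤ X w x)
    (hXK : ∀ w x, w ≠ 0 → 0 < x → |X w x - x| ≤ K / ‖w‖) :
    Tendsto (fun w => exp (log w / 2) * ∫ x in Set.Ioi (0 : ℝ), saddleIntegrand b α w (X w x))
      (cobounded ℂ ⊓ 𝓟 (reSector κ))
      (𝓝 (exp (-α * (Real.log (2 * Real.pi) / 2 : ℝ)) * (√(2 * Real.pi / α) : ℝ))) := by
  set l := cobounded ℂ ⊓ 𝓟 (reSector κ) with hl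
  have : (cobounded ℂ).IsCountablyGenerated := by rw [← comap_norm_atTop]; infer_instance
  have hR : Tendsto (fun w : ℂ => ‖w‖) l atTop := tendsto_norm_cobounded_atTop.mono_left inf_le_left
  have hmem : ∀ᶠ w in l, w ∈ reSector κ := mem_inf_of_right (mem_principal_self _)
  have hge : ∀ᶠ w : ℂ in l, 1 ≤ ‖w‖ := hR.eventually_ge_atTop 1
  -- Substitution x = 1 + t/√|w|, extended by zero so that t ranges over the whole line.
  set D : ℂ → ℝ → ℂ := fun w t =>
    (Set.Ioi (0 : ℝ)).indicator (fun x => saddleIntegrand b α w (X w x)) (1 + t / √‖w‖) with hD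
  obtain ⟨C, β, hC, hβ, hbound⟩ := exists_norm_saddleIntegrand_le hb hα hκ
  have hre : ∀ w : ℂ, w ∈ reSector κ → 1 ≤ ‖w‖ → 0 < w.re := fun w hw h1 =>
    lt_of_lt_of_le (by positivity) (show κ * ‖w‖ ≤ w.re from hw)
  have hDm : ∀ w : ℂ, w ∈ reSector κ → 1 ≤ ‖w‖ → Measurable (D w) := fun w hw h1 =>
    (measurable_saddleIntegrand_comp hb α (hre w hw h1) (hXm w) (hX0 w)).comp (by fun_prop)
  have hDb : ∀ w : ℂ, w ∈ reSector κ → 1 ≤ ‖w‖ → ∀ t : ℝ,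
      ‖D w t‖ ≤ C * Real.exp (β * K) * Real.exp (-(β * |t|)) := fun w hw h1 t => by
    rcases le_or_gt (1 + t / √‖w‖) 0 with hx | hx
    · simp only [hD]
      rw [Set.indicator_of_notMem (by simpa using hx), norm_zero]
      positivity
    · simp only [hD]
      rw [Set.indicator_of_mem (by exact hx)]
      refine (hbound w hw h1 _ (hX0 w _ hx)).trans ?_
      rw [mul_assoc, ← Real.exp_add]
      gcongr
      set x := 1 + t / √‖w‖ with hxdef
      have hw0 : w ≠ 0 := by rintro rfl; norm_num at h1
      have hs : 1 ≤ √‖w‖ := Real.one_le_sqrt.2 h1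
      have hs2 : √‖w‖ * √‖w‖ = ‖w‖ := Real.mul_self_sqrt (norm_nonneg w)
      have e1 : |t| = √‖w‖ * |x - 1| := by
        rw [hxdef, add_sub_cancel_left, abs_div, abs_of_pos (by positivity : 0 < √‖w‖)]
        field_simp
      have e2 : |x - 1| ≤ |X w x - 1| + K / ‖w‖ := by
        have h3 := hXK w x hw0 hx
        have h4 := abs_sub_le x (X w x) 1
        rw [abs_sub_comm x (X w x)] at h4
        linarith
      have hK : 0 ≤ K := by
        have := (abs_nonneg _).trans (hXK w x hw0 hx)
        by_contra hneg
        exact absurd this (not_le.2 (div_neg_of_neg_of_pos (not_le.1 hneg) (by positivity)))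
      -- On the scale t the perturbation is at most K/√|w| ≤ K: it costs only the factor exp(βK) in
      -- the majorant and vanishes in the limit.
      have e3 : √‖w‖ * (K / ‖w‖) ≤ K := by
        rw [mul_div_assoc', div_le_iff₀ (by positivity)]
        have : √‖w‖ ≤ ‖w‖ := by nlinarith
        nlinarith
      have e4 : |t| ≤ √‖w‖ * |X w x - 1| + K := by
        rw [e1]
        calc _ ≤ √‖w‖ * (|X w x - 1| + K / ‖w‖) := by gcongr
          _ ≤ _ := by rw [mul_add]; gcongr
      nlinarith
  have hGi : ∀ w : ℂ, w ∈ reSector κ → 1 ≤ ‖w‖ →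
      MeasureTheory.Integrable (saddleGaussian α w) := fun w hw h1 => by
    have hw0 : w ≠ 0 := by rintro rfl; norm_num at h1
    refine (integrable_cexp_neg_mul_sq ?_).const_mul _
    rw [show (α / 2 * (w / ‖w‖) : ℂ) = ((α / 2 : ℝ) : ℂ) * (w / ‖w‖) by push_cast; ring,
      re_ofReal_mul]
    have := hκ.trans_le (le_re_div_norm hw hw0)
    positivity
  have hDi : ∀ w : ℂ, w ∈ reSector κ → 1 ≤ ‖w‖ → MeasureTheory.Integrable (D w) :=
    fun w hw h1 => ((integrable_exp_neg_mul_abs hβ).const_mul (C * Real.exp (β * K))).mono'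
      (hDm w hw h1).aestronglyMeasurable (Eventually.of_forall (hDb w hw h1))
  set k := exp (-α * (Real.log (2 * Real.pi) / 2 : ℝ)) with hk
  have hdct : Tendsto (fun w => ∫ t : ℝ, (D w t - saddleGaussian α w t)) l
      (𝓝 (∫ _ : ℝ, (0 : ℂ))) := by
    refine MeasureTheory.tendsto_integral_filter_of_dominated_convergence
      (fun t => C * Real.exp (β * K) * Real.exp (-(β * |t|)) +
        ‖k‖ * Real.exp (-(α * κ / 2) * t ^ 2)) ?_ ?_ ?_ ?_
    · filter_upwards [hmem, hge] with w hw h1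
      exact ((hDi w hw h1).sub (hGi w hw h1)).aestronglyMeasurable
    · filter_upwards [hmem, hge] with w hw h1
      refine Eventually.of_forall fun t => (norm_sub_le _ _).trans ?_
      have hw0 : w ≠ 0 := by rintro rfl; norm_num at h1
      refine add_le_add (hDb w hw h1 t) ?_
      rw [saddleGaussian, norm_mul]
      gcongr
      exact norm_gaussian_le hα hw hw0 t
    · exact ((integrable_exp_neg_mul_abs hβ).const_mul _).add
        ((integrable_exp_neg_mul_sq (by positivity)).const_mul _)
    · refine Eventually.of_forall fun t => ?_
      have hs : Tendsto (fun w : ℂ => √‖w‖) l atTop := Real.tendsto_sqrt_atTop.comp hR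
      have hx1 : Tendsto (fun w : ℂ => 1 + t / √‖w‖) l (𝓝 1) := by
        simpa using (hs.const_div_atTop t).const_add 1
      have hxpos : ∀ᶠ w : ℂ in l, 0 < 1 + t / √‖w‖ := hx1.eventually_const_lt one_pos
      have hξ : Tendsto (fun w : ℂ => √‖w‖ * (X w (1 + t / √‖w‖) - 1)) l (𝓝 t) := by
        refine tendsto_iff_dist_tendsto_zero.2 (squeeze_zero' (Eventually.of_forall fun _ =>
          dist_nonneg) ?_ (hs.const_div_atTop K))
        filter_upwards [hxpos, hge] with w hx h1
        have hw0 : w ≠ 0 := by rintro rfl; norm_num at h1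
        have hs0 : 0 < √‖w‖ := Real.sqrt_pos.2 (by linarith)
        have hs2 : √‖w‖ * √‖w‖ = ‖w‖ := Real.mul_self_sqrt (norm_nonneg w)
        have h3 := hXK w _ hw0 hx
        rw [Real.dist_eq]
        have e : √‖w‖ * (X w (1 + t / √‖w‖) - 1) - t =
            √‖w‖ * (X w (1 + t / √‖w‖) - (1 + t / √‖w‖)) := by field_simp; ring
        rw [e, abs_mul, abs_of_pos hs0]
        calc _ ≤ √‖w‖ * (K / ‖w‖) := by gcongr
          _ = K / √‖w‖ := by
            have : ‖w‖ ≠ 0 := by linarith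
            rw [mul_div_assoc', div_eq_div_iff this hs0.ne']
            linear_combination K * hs2
      refine (tendsto_saddleIntegrand_sub hb hα hκ hξ).congr' ?_
      filter_upwards [hxpos] with w hx
      simp only [hD]
      rw [Set.indicator_of_mem (by exact hx)]
  rw [MeasureTheory.integral_zero] at hdct
  have hphase : ∀ᶠ w : ℂ in l, ‖exp (log w / 2) / (√‖w‖ : ℝ)‖ ≤ 1 := by
    filter_upwards [hge] with w h1
    have hpos : 0 < ‖w‖ := by linarith
    rw [norm_div, norm_real, norm_exp, Real.norm_of_nonneg (Real.sqrt_nonneg _),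
      Real.sqrt_eq_rpow, Real.rpow_def_of_pos hpos]
    rw [show log w / 2 = ((1 / 2 : ℝ) : ℂ) * log w by push_cast; ring, re_ofReal_mul, log_re,
      mul_comm, div_self (Real.exp_pos _).ne']
  have h0 : Tendsto (fun w => exp (log w / 2) / (√‖w‖ : ℝ) *
      ∫ t : ℝ, (D w t - saddleGaussian α w t)) l (𝓝 0) := by
    have := hdct.norm
    rw [norm_zero] at this
    refine squeeze_zero_norm' ?_ this
    filter_upwards [hphase] with w h1
    rw [norm_mul]
    exact mul_le_of_le_one_left (norm_nonneg _) h1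
  have h1 := h0.add_const (k * (√(2 * Real.pi / α) : ℝ))
  rw [zero_add] at h1
  refine h1.congr' ?_
  filter_upwards [hmem, hge] with w hw hw1
  have hw0 : w ≠ 0 := by rintro rfl; norm_num at hw1
  have hs0 : 0 < √‖w‖ := Real.sqrt_pos.2 (by linarith)
  have hDint : ∫ t : ℝ, D w t =
      √‖w‖ • ∫ x in Set.Ioi (0 : ℝ), saddleIntegrand b α w (X w x) := by
    rw [← MeasureTheory.integral_indicator measurableSet_Ioi]
    simp only [hD]
    rw [MeasureTheory.Measure.integral_comp_div (fun s => (Set.Ioi (0 : ℝ)).indicator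
      (fun x => saddleIntegrand b α w (X w x)) (1 + s)), abs_of_pos hs0,
      MeasureTheory.integral_add_left_eq_self]
  rw [MeasureTheory.integral_sub (hDi w hw hw1) (hGi w hw hw1), mul_sub,
    integral_saddleGaussian hα hκ hw hw0, hDint, sub_add_cancel, real_smul]
  have : ((√‖w‖ : ℝ) : ℂ) ≠ 0 := by exact_mod_cast hs0.ne'
  field_simp

/-! ### The main term and the proof of the asymptotics -/

/-- The principal power `z ^ (1 / c)`, as an exponential. -/
noncomputable def rootExp (c : ℝ) (z : ℂ) : ℂ := exp (log z / c)

lemma log_rootExp {c : ℝ} {z : ℂ} (h : |arg z / c| < Real.pi) : log (rootExp c z) = log z / c := by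
  rw [abs_lt] at h
  refine log_exp ?_ ?_ <;> rw [div_ofReal_im, log_im]
  exacts [h.1, h.2.le]

lemma norm_rootExp {c : ℝ} {z : ℂ} (hz : z ≠ 0) : ‖rootExp c z‖ = ‖z‖ ^ (1 / c) := by
  rw [rootExp, norm_exp, div_ofReal_re, log_re, Real.rpow_def_of_pos (norm_pos_iff.2 hz)]
  congr 1
  ring

lemma rootExp_eq {c : ℝ} {z : ℂ} :
    rootExp c z = (‖rootExp c z‖ : ℝ) * exp ((arg z / c : ℝ) * I) := by
  have : log z / c = ((log z).re / c : ℝ) + (arg z / c : ℝ) * I := by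
    conv_lhs => rw [← re_add_im (log z), log_im]
    push_cast
    ring
  rw [rootExp, norm_exp, div_ofReal_re, this, exp_add, ofReal_exp]

lemma re_rootExp {c : ℝ} {z : ℂ} :
    (rootExp c z).re = ‖rootExp c z‖ * Real.cos (arg z / c) := by
  conv_lhs => rw [rootExp_eq, re_ofReal_mul_exp_mul_I]

lemma rootExp_ne_zero (c : ℝ) (z : ℂ) : rootExp c z ≠ 0 := exp_ne_zero _

/-- The interpolating function on the ray through the saddle point. -/
lemma mlInterp_eq_saddleIntegrand {a b α : ℝ} (ha : 0 < a) (hα : 0 < α) {z : ℂ}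
    (hlog : log (rootExp (a * α) z) = log z / ((a * α : ℝ) : ℂ)) {x : ℝ} (hx : 0 ≤ x) :
    mlInterp a b α z (rootExp (a * α) z * x / a) =
      exp (α * rootExp (a * α) z) *
        exp (-((α * (b - 1 / 2) : ℝ) * log (rootExp (a * α) z))) *
          saddleIntegrand b α (rootExp (a * α) z) x := by
  have ha' : (a : ℂ) ≠ 0 := by exact_mod_cast ha.ne'
  have hα' : (α : ℂ) ≠ 0 := by exact_mod_cast hα.ne'
  have hlogz : log z = a * α * log (rootExp (a * α) z) := by
    rw [hlog]; push_cast; field_simp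
  have hw0 := rootExp_ne_zero (a * α) z
  generalize rootExp (a * α) z = w at *
  rw [mlInterp, mlCoeff_eq_gammaQuot, saddleIntegrand, hlogz,
    show (a * (w * x / a) : ℂ) = w * x by field_simp]
  rw [show ∀ A B C D E G : ℂ, A * B * (C * D * E) = D * (A * E * (B * C)) by intros; ring,
    ← exp_add, ← exp_add, mul_assoc, ← exp_add]
  · congr 1
    rw [neg_add_cancel, exp_zero, mul_one]
    congr 1
    rcases hx.eq_or_lt with rfl | hx
    · simp [phase]
    · rw [log_mul_ofReal x hx w hw0, phase]
      push_cast
      field_simp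
      ring
  -- The variable G does not occur in the rearrangement, so its value is left open and may be
  -- arbitrary.
  · exact 0

lemma mlMain_eq {a b α : ℝ} (ha : 0 < a) (hα : 0 < α) {z : ℂ} (hz : z ≠ 0)
    (hlog : log (rootExp (a * α) z) = log z / ((a * α : ℝ) : ℂ)) :
    mlMain a b α z = ((1 / (a * √α) * (2 * Real.pi) ^ ((1 - α) / 2) : ℝ) : ℂ) *
      exp (((1 / 2 - α * (b - 1 / 2) : ℝ) : ℂ) * log (rootExp (a * α) z)) *
        exp (α * rootExp (a * α) z) := by
  have ha' : (a : ℂ) ≠ 0 := by exact_mod_cast ha.ne'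
  have hα' : (α : ℂ) ≠ 0 := by exact_mod_cast hα.ne'
  rw [mlMain, cpow_def_of_ne_zero hz, cpow_def_of_ne_zero hz, hlog, rootExp]
  congr 2
  · congr 1
    push_cast
    field_simp
    ring
  · congr 2
    push_cast
    field_simp

lemma saddle_const_eq {a α : ℝ} (ha : 0 < a) (hα : 0 < α) :
    exp (-α * (Real.log (2 * Real.pi) / 2 : ℝ)) * (√(2 * Real.pi / α) : ℝ) =
      a * ((1 / (a * √α) * (2 * Real.pi) ^ ((1 - α) / 2) : ℝ) : ℂ) := by
  have hpi : 0 < 2 * Real.pi := by have := Real.pi_pos; positivity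
  have hs := Real.sqrt_pos.2 hα
  have : Real.exp (-α * (Real.log (2 * Real.pi) / 2)) * √(2 * Real.pi / α) =
      a * (1 / (a * √α) * (2 * Real.pi) ^ ((1 - α) / 2)) := by
    rw [Real.sqrt_div hpi.le, Real.sqrt_eq_rpow (2 * Real.pi), Real.rpow_def_of_pos hpi,
      Real.rpow_def_of_pos hpi,
      show Real.log (2 * Real.pi) * ((1 - α) / 2) =
        -α * (Real.log (2 * Real.pi) / 2) + Real.log (2 * Real.pi) * (1 / 2) by ring, Real.exp_add]
    field_simp
  exact_mod_cast congrArg ((↑) : ℝ → ℂ) this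

/-- The Jacobian w/a supplies the missing power: w · w^(-α(b-1/2)) = w^(1/2) · w^(1/2-α(b-1/2)),
where the first factor normalizes the saddle integral and the second is the power in the main term.
-/
lemma saddle_div_mlMain {a b α : ℝ} (ha : 0 < a) (hα : 0 < α) {z : ℂ} (hz : z ≠ 0)
    (hlog : log (rootExp (a * α) z) = log z / ((a * α : ℝ) : ℂ)) {X : ℝ → ℝ}
    (hX : ∀ x, 0 < x → 0 ≤ X x) :
    (rootExp (a * α) z / a *
      ∫ x in Set.Ioi (0 : ℝ), mlInterp a b α z (rootExp (a * α) z * X x / a)) / mlMain a b α z =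
      (exp (log (rootExp (a * α) z) / 2) *
        ∫ x in Set.Ioi (0 : ℝ), saddleIntegrand b α (rootExp (a * α) z) (X x)) /
        (exp (-α * (Real.log (2 * Real.pi) / 2 : ℝ)) * (√(2 * Real.pi / α) : ℝ)) := by
  have h1 : ∫ x in Set.Ioi (0 : ℝ), mlInterp a b α z (rootExp (a * α) z * X x / a) =
      exp (α * rootExp (a * α) z) * exp (-((α * (b - 1 / 2) : ℝ) * log (rootExp (a * α) z))) *
        ∫ x in Set.Ioi (0 : ℝ), saddleIntegrand b α (rootExp (a * α) z) (X x) := by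
    rw [← MeasureTheory.integral_const_mul]
    refine MeasureTheory.setIntegral_congr_fun measurableSet_Ioi fun x hx => ?_
    exact mlInterp_eq_saddleIntegrand ha hα hlog (hX x hx)
  rw [h1, mlMain_eq ha hα hz hlog, saddle_const_eq ha hα]
  have hw0 := rootExp_ne_zero (a * α) z
  have hpos : 0 < 1 / (a * √α) * (2 * Real.pi) ^ ((1 - α) / 2) := by
    have := Real.pi_pos
    have := Real.sqrt_pos.2 hα
    positivity
  generalize rootExp (a * α) z = w at *
  generalize (∫ x in Set.Ioi (0 : ℝ), saddleIntegrand b α w (X x)) = S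
  have hM : ((1 / (a * √α) * (2 * Real.pi) ^ ((1 - α) / 2) : ℝ) : ℂ) ≠ 0 := by
    exact_mod_cast hpos.ne'
  generalize ((1 / (a * √α) * (2 * Real.pi) ^ ((1 - α) / 2) : ℝ) : ℂ) = M at *
  have ha' : (a : ℂ) ≠ 0 := by exact_mod_cast ha.ne'
  have e : w * exp (-((α * (b - 1 / 2) : ℝ) * log w)) =
      exp (log w / 2) * exp (((1 / 2 - α * (b - 1 / 2) : ℝ) : ℂ) * log w) := by
    conv_lhs => rw [← exp_log hw0, log_exp (neg_pi_lt_log_im w) (log_im_le_pi w)]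
    rw [← exp_add, ← exp_add]
    congr 1
    push_cast
    ring
  rw [div_eq_div_iff (mul_ne_zero (mul_ne_zero hM (exp_ne_zero _)) (exp_ne_zero _))
    (mul_ne_zero ha' hM)]
  rw [show ∀ E N : ℂ, w / a * (E * N * S) * (a * M) = w * N * (E * S * M) by
    intros; field_simp, e]
  ring

/-- For aα ≥ 4 this replaces Poisson summation: the series becomes an integral with perturbed
evaluation points. -/
lemma tsum_eq_integral_floor {f : ℕ → ℂ} (hf : Summable f) :
    ∑' n, f n = ∫ y in Set.Ioi (0 : ℝ), f ⌊y⌋₊ := by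
  have hU : Set.Ici (0 : ℝ) = ⋃ n : ℕ, Set.Ico (n : ℝ) (n + 1) := by
    ext y
    simp only [Set.mem_Ici, Set.mem_iUnion, Set.mem_Ico]
    exact ⟨fun hy => ⟨⌊y⌋₊, Nat.floor_le hy, Nat.lt_floor_add_one y⟩,
      fun ⟨n, h, _⟩ => (Nat.cast_nonneg n).trans h⟩
  have hfl : ∀ n : ℕ, ∀ y ∈ Set.Ico (n : ℝ) (n + 1), ⌊y⌋₊ = n := fun n y hy =>
    (Nat.floor_eq_iff ((Nat.cast_nonneg n).trans hy.1)).2 hy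
  have hvol : ∀ n : ℕ, MeasureTheory.volume.real (Set.Ico (n : ℝ) (n + 1)) = 1 := fun n => by
    rw [Real.volume_real_Ico_of_le (by linarith)]; ring
  have hint : ∀ n : ℕ, MeasureTheory.IntegrableOn (fun y : ℝ => f ⌊y⌋₊) (Set.Ico (n : ℝ) (n + 1)) :=
    fun n => (MeasureTheory.integrableOn_const (C := f n) (by simp)).congr_fun
      (fun y hy => by simp only [hfl n y hy]) measurableSet_Ico
  have hval : ∀ n : ℕ, ∫ y in Set.Ico (n : ℝ) (n + 1), f ⌊y⌋₊ = f n := fun n => by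
    rw [MeasureTheory.setIntegral_congr_fun measurableSet_Ico
      (g := fun _ => f n) (fun y hy => by simp only [hfl n y hy]),
      MeasureTheory.setIntegral_const, hvol, one_smul]
  have hnorm : ∀ n : ℕ, ∫ y in Set.Ico (n : ℝ) (n + 1), ‖f ⌊y⌋₊‖ = ‖f n‖ := fun n => by
    rw [MeasureTheory.setIntegral_congr_fun measurableSet_Ico
      (g := fun _ => ‖f n‖) (fun y hy => by simp only [hfl n y hy]),
      MeasureTheory.setIntegral_const, hvol, one_smul]
  have hI : MeasureTheory.IntegrableOn (fun y : ℝ => f ⌊y⌋₊) (⋃ n : ℕ, Set.Ico (n : ℝ) (n + 1)) :=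
    MeasureTheory.integrableOn_iUnion_of_summable_integral_norm
      hint (by simpa only [hnorm] using hf.norm)
  have hdisj : Pairwise (Function.onFun Disjoint fun n : ℕ => Set.Ico (n : ℝ) (n + 1)) := by
    intro m n hmn
    refine Set.disjoint_left.2 fun y hm hn => hmn ?_
    rw [← hfl m y hm, hfl n y hn]
  rw [← MeasureTheory.integral_Ici_eq_integral_Ioi, hU,
    MeasureTheory.integral_iUnion (fun _ => measurableSet_Ico) hdisj hI]
  exact tsum_congr fun n => (hval n).symm

lemma integral_mlInterp_eq_ray {a b α : ℝ} (ha : 0 < a) (hb : 0 < b) (hα : 0 < α) {z : ℂ}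
    (h : |arg z / (a * α)| < Real.pi / 2) :
    ∫ x in Set.Ioi (0 : ℝ), mlInterp a b α z x = rootExp (a * α) z / a *
      ∫ x in Set.Ioi (0 : ℝ), mlInterp a b α z (rootExp (a * α) z * x / a) := by
  set φ := arg z / (a * α) with hφ
  have hcos : 0 < Real.cos φ := Real.cos_pos_of_mem_Ioo (abs_lt.1 h)
  -- The constant κ = cos φ serves all intermediate rays, since |ψ| ≤ |φ| gives cos ψ ≥ cos φ.
  obtain ⟨C, hC⟩ := exists_norm_mlInterp_le_of_sector ha hb hα z hcos
  rw [integral_Ioi_eq_integral_ray (div_pos hb ha) (differentiableOn_mlInterp ha α z) h.le one_pos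
    (C := C) (fun r hr ψ hψ => by
      have h1 := hC (r * exp (ψ * I)) (by
        rw [norm_ofReal_mul_exp_mul_I hr.le, re_ofReal_mul_exp_mul_I, mul_comm]
        gcongr
        rw [← Real.cos_abs φ, ← Real.cos_abs ψ]
        exact Real.cos_le_cos_of_nonneg_of_le_pi (abs_nonneg _)
          (by linarith [Real.pi_pos]) (abs_le_of_mem_uIcc_zero hψ))
      rw [norm_ofReal_mul_exp_mul_I hr.le] at h1
      rwa [one_mul])]
  have hR : 0 < ‖rootExp (a * α) z‖ := norm_pos_iff.2 (rootExp_ne_zero _ _)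
  have hsub := MeasureTheory.integral_comp_mul_left_Ioi
    (fun r : ℝ => mlInterp a b α z (r * exp (φ * I))) 0 (div_pos hR ha)
  rw [mul_zero] at hsub
  have e : ∀ x : ℝ, ((‖rootExp (a * α) z‖ / a * x : ℝ) : ℂ) * exp (φ * I) =
      rootExp (a * α) z * x / a := fun x => by
    conv_rhs => rw [rootExp_eq, ← hφ]
    push_cast
    ring
  simp only [e] at hsub
  rw [hsub, real_smul]
  conv_rhs => rw [rootExp_eq, ← hφ]
  have hRc : ((‖rootExp (a * α) z‖ : ℝ) : ℂ) ≠ 0 := by exact_mod_cast hR.ne'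
  have ha' : (a : ℂ) ≠ 0 := by exact_mod_cast ha.ne'
  rw [norm_mul, norm_exp_ofReal_mul_I, norm_real, norm_norm, mul_one]
  generalize (∫ r in Set.Ioi (0 : ℝ), mlInterp a b α z (r * exp (φ * I))) = S
  push_cast
  field_simp

/-- The sector is cut out by the smaller of two bounds, which cross at aα = 2, so both always hold.
The first permits rotation to the saddle ray, the second Poisson summation. -/
lemma arg_bounds_of_mem_mlSector {a α ε : ℝ} (ha : 0 < a) (hα : 0 < α) (h4 : a * α < 4)
    {z : ℂ} (hz : z ∈ mlSector a α ε) :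
    |arg z / (a * α)| ≤ Real.pi / 2 - ε / (a * α) ∧
      Real.pi * (a * α) / 2 + |arg z| ≤ 2 * Real.pi - ε := by
  have hc : 0 < a * α := by positivity
  have hpi := Real.pi_pos
  have hz : |arg z| ≤ argBound a α ε := hz
  rw [argBound] at hz
  have h1 : |arg z| ≤ a * α / 2 * Real.pi - ε ∧ |arg z| ≤ (2 - a * α / 2) * Real.pi - ε := by
    split_ifs at hz with h
    · exact ⟨hz, hz.trans (by nlinarith)⟩
    · exact ⟨hz.trans (by nlinarith), hz⟩
  constructor
  · rw [abs_div, abs_of_pos hc, div_le_iff₀ hc, sub_mul, div_mul_cancel₀ _ hc.ne']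
    linarith [h1.1]
  · linarith [h1.2]

lemma arg_eq_zero_of_mem_mlSector {a α ε : ℝ} (h4 : 4 ≤ a * α) {z : ℂ}
    (hz : z ∈ mlSector a α ε) : arg z = 0 := by
  have hz : |arg z| ≤ argBound a α ε := hz
  rw [argBound, if_neg (by linarith), if_neg (by linarith)] at hz
  exact abs_nonpos_iff.1 hz

lemma tendsto_rootExp {c κ : ℝ} (hc : 0 < c) {T : Set ℂ}
    (hT : ∀ z ∈ T, κ ≤ Real.cos (arg z / c)) :
    Tendsto (rootExp c) (cobounded ℂ ⊓ 𝓟 T) (cobounded ℂ ⊓ 𝓟 (reSector κ)) := by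
  refine tendsto_inf.2 ⟨Tendsto.mono_left ?_ inf_le_left, tendsto_principal.2 ?_⟩
  · rw [← tendsto_norm_atTop_iff_cobounded]
    refine ((tendsto_rpow_atTop (y := 1 / c) (by positivity)).comp
      tendsto_norm_cobounded_atTop).congr' ?_
    filter_upwards [eventually_ne_cobounded 0] with z hz
    exact (norm_rootExp hz).symm
  · filter_upwards [mem_inf_of_right (mem_principal_self _)] with z hz
    show κ * ‖rootExp c z‖ ≤ (rootExp c z).re
    rw [re_rootExp, mul_comm]
    gcongr
    exact hT z hz

lemma mlMain_ne_zero {a α : ℝ} (ha : 0 < a) (b : ℝ) (hα : 0 < α) {z : ℂ} (hz : z ≠ 0) :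
    mlMain a b α z ≠ 0 := by
  have hpi := Real.pi_pos
  have hs := Real.sqrt_pos.2 hα
  have hpos : 0 < 1 / (a * √α) * (2 * Real.pi) ^ ((1 - α) / 2) := by positivity
  have hM : ((1 / (a * √α) * (2 * Real.pi) ^ ((1 - α) / 2) : ℝ) : ℂ) ≠ 0 := by
    exact_mod_cast hpos.ne'
  rw [mlMain, cpow_def_of_ne_zero hz]
  exact mul_ne_zero (mul_ne_zero hM (exp_ne_zero _)) (exp_ne_zero _)

lemma saddle_const_ne_zero {α : ℝ} (hα : 0 < α) :
    exp (-α * (Real.log (2 * Real.pi) / 2 : ℝ)) * (√(2 * Real.pi / α) : ℝ) ≠ 0 := by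
  have hpi := Real.pi_pos
  refine mul_ne_zero (exp_ne_zero _) ?_
  exact_mod_cast (Real.sqrt_pos.2 (by positivity : 0 < 2 * Real.pi / α)).ne'

/-- The saddle point asymptotics in terms of `z`, relative to the main term. -/
lemma tendsto_saddle_div_mlMain {a b α κ K : ℝ} (ha : 0 < a) (hb : 0 < b) (hα : 0 < α)
    (hκ : 0 < κ) {T : Set ℂ} (hT : ∀ z ∈ T, |arg z / (a * α)| < Real.pi / 2)
    (hT' : ∀ z ∈ T, κ ≤ Real.cos (arg z / (a * α)))
    {X : ℂ → ℝ → ℝ} (hXm : ∀ w, Measurable (X w)) (hX0 : ∀ w x, 0 < x → 0 ≤ X w x)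
    (hXK : ∀ w x, w ≠ 0 → 0 < x → |X w x - x| ≤ K / ‖w‖) :
    Tendsto (fun z => (rootExp (a * α) z / a * ∫ x in Set.Ioi (0 : ℝ),
      mlInterp a b α z (rootExp (a * α) z * X (rootExp (a * α) z) x / a)) / mlMain a b α z)
      (cobounded ℂ ⊓ 𝓟 T) (𝓝 1) := by
  have h1 := ((tendsto_integral_saddleIntegrand hb hα hκ hXm hX0 hXK).comp
    (tendsto_rootExp (by positivity : 0 < a * α) hT')).div_const
      (exp (-α * (Real.log (2 * Real.pi) / 2 : ℝ)) * (√(2 * Real.pi / α) : ℝ))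
  rw [div_self (saddle_const_ne_zero hα)] at h1
  refine h1.congr' ?_
  filter_upwards [mem_inf_of_left (eventually_ne_cobounded 0),
    mem_inf_of_right (mem_principal_self _)] with z hz hzT
  have hlog := log_rootExp ((hT z hzT).trans (by linarith [Real.pi_pos]))
  exact (saddle_div_mlMain ha hα hz hlog (hX0 _)).symm

lemma le_norm_mlMain {a b α κ : ℝ} (ha : 0 < a) (hα : 0 < α) {z : ℂ} (hz : z ≠ 0)
    (h : |arg z / (a * α)| < Real.pi / 2) (hκ : κ ≤ Real.cos (arg z / (a * α))) :
    (1 / (a * √α) * (2 * Real.pi) ^ ((1 - α) / 2)) *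
      (‖rootExp (a * α) z‖ ^ (1 / 2 - α * (b - 1 / 2)) *
        Real.exp (α * κ * ‖rootExp (a * α) z‖)) ≤ ‖mlMain a b α z‖ := by
  have hpi := Real.pi_pos
  rw [mlMain_eq ha hα hz (log_rootExp (h.trans (by linarith))), norm_mul, norm_mul, norm_real,
    Real.norm_of_nonneg (by positivity), norm_exp_ofReal_mul_log _ (rootExp_ne_zero _ _),
    norm_exp (α * _), re_ofReal_mul, re_rootExp, ← mul_assoc]
  refine mul_le_mul_of_nonneg_left (Real.exp_le_exp.2 ?_) (by positivity)
  have : α * (‖rootExp (a * α) z‖ * κ) ≤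
      α * (‖rootExp (a * α) z‖ * Real.cos (arg z / (a * α))) := by gcongr
  linarith

/-- Here log|z| = aα log|w|, whereas the main term is at least a power of |w| times exp(ακ|w|). -/
lemma tendsto_log_div_mlMain {a b α κ : ℝ} (ha : 0 < a) (hα : 0 < α)
    (hκ : 0 < κ) {T : Set ℂ} (hT : ∀ z ∈ T, |arg z / (a * α)| < Real.pi / 2)
    (hT' : ∀ z ∈ T, κ ≤ Real.cos (arg z / (a * α))) :
    Tendsto (fun z => (1 + Real.log ‖z‖) / ‖mlMain a b α z‖) (cobounded ℂ ⊓ 𝓟 T) (𝓝 0) := by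
  have hc : 0 < a * α := by positivity
  set M := 1 / (a * √α) * (2 * Real.pi) ^ ((1 - α) / 2) with hM
  set p := 1 / 2 - α * (b - 1 / 2) with hp
  have hM0 : 0 < M := by have := Real.pi_pos; have := Real.sqrt_pos.2 hα; positivity
  have hR : Tendsto (fun z => ‖rootExp (a * α) z‖) (cobounded ℂ ⊓ 𝓟 T) atTop :=
    tendsto_norm_cobounded_atTop.comp (tendsto_inf.1 (tendsto_rootExp hc hT')).1
  have h1 := ((tendsto_rpow_mul_exp_neg_mul_atTop_nhds_zero (1 - p) (α * κ)
    (by positivity)).comp hR).const_mul ((1 + a * α) / M)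
  rw [mul_zero] at h1
  refine squeeze_zero' ?_ ?_ h1
  · filter_upwards [mem_inf_of_left (eventually_cobounded_le_norm 1)] with z hz
    have := Real.log_nonneg hz
    positivity
  · filter_upwards [mem_inf_of_left (eventually_cobounded_le_norm 1),
      mem_inf_of_right (mem_principal_self _), hR.eventually_ge_atTop 1] with z hz hzT hR1
    have hz0 : z ≠ 0 := by rintro rfl; norm_num at hz
    have hle := le_norm_mlMain (b := b) ha hα hz0 (hT z hzT) (hT' z hzT)
    have hnr := norm_rootExp (c := a * α) hz0
    have hlog : Real.log ‖z‖ = a * α * Real.log ‖rootExp (a * α) z‖ := by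
      rw [hnr, Real.log_rpow (norm_pos_iff.2 hz0)]; field_simp
    rw [← hM, ← hp] at hle
    simp only [Function.comp_apply]
    generalize ‖rootExp (a * α) z‖ = R at *
    have hR0 : 0 < R := by linarith
    have hlogR : Real.log R ≤ R := (Real.log_le_sub_one_of_pos hR0).trans (by linarith)
    have hnum : 1 + Real.log ‖z‖ ≤ (1 + a * α) * R := by
      rw [hlog]
      have : a * α * Real.log R ≤ a * α * R := by gcongr
      linarith
    have hlow : 0 < M * (R ^ p * Real.exp (α * κ * R)) := by positivity
    calc _ ≤ (1 + a * α) * R / (M * (R ^ p * Real.exp (α * κ * R))) := by gcongr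
      _ = _ := by
        rw [neg_mul, Real.exp_neg, Real.rpow_sub hR0 1 p, Real.rpow_one]
        field_simp

lemma tendsto_mlF_div_mlMain_of_lt_four {a b α ε : ℝ} (ha : 0 < a) (hb : 0 < b) (hα : 0 < α)
    (hε : 0 < ε) (h4 : a * α < 4) :
    Tendsto (fun z => mlF a b α z / mlMain a b α z) (cobounded ℂ ⊓ 𝓟 (mlSector a α ε))
      (𝓝 1) := by
  have hc : 0 < a * α := by positivity
  have hpi := Real.pi_pos
  have hεc : 0 < ε / (a * α) := by positivity
  -- The minimum keeps κ positive even for ε so large that the sector is empty.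
  set κ := Real.sin (min (ε / (a * α)) (Real.pi / 2)) with hκdef
  have hκ : 0 < κ := Real.sin_pos_of_pos_of_lt_pi (by positivity)
    ((min_le_right _ _).trans_lt (by linarith))
  have hT : ∀ z ∈ mlSector a α ε, |arg z / (a * α)| < Real.pi / 2 := fun z hz =>
    (arg_bounds_of_mem_mlSector ha hα h4 hz).1.trans_lt (by linarith)
  have hT' : ∀ z ∈ mlSector a α ε, κ ≤ Real.cos (arg z / (a * α)) := fun z hz => by
    have h1 := (arg_bounds_of_mem_mlSector ha hα h4 hz).1
    have h2 : ε / (a * α) ≤ Real.pi / 2 := by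
      have := abs_nonneg (arg z / (a * α)); linarith
    rw [hκdef, min_eq_left h2, ← Real.cos_pi_div_two_sub, ← Real.cos_abs (arg z / (a * α))]
    exact Real.cos_le_cos_of_nonneg_of_le_pi (abs_nonneg _) (by linarith) h1
  have h1 := tendsto_saddle_div_mlMain (b := b) (X := fun _ x => x) (K := 0) ha hb hα hκ hT hT'
    (fun _ => measurable_id) (fun _ _ h => h.le) (fun _ _ _ _ => by simp)
  obtain ⟨C, hC⟩ := exists_norm_mlF_sub_integral_le ha hb hα hε
  have h2 : Tendsto (fun z => (mlF a b α z - ∫ x in Set.Ioi (0 : ℝ), mlInterp a b α z x) /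
      mlMain a b α z) (cobounded ℂ ⊓ 𝓟 (mlSector a α ε)) (𝓝 0) := by
    have h3 := (tendsto_log_div_mlMain (b := b) ha hα hκ hT hT').const_mul C
    rw [mul_zero] at h3
    refine squeeze_zero_norm' ?_ h3
    filter_upwards [mem_inf_of_left (eventually_cobounded_le_norm 1),
      mem_inf_of_right (mem_principal_self _)] with z hz hzT
    rw [norm_div, mul_div_assoc']
    gcongr
    exact hC z hz (arg_bounds_of_mem_mlSector ha hα h4 hzT).2
  have h3 := h1.add h2
  rw [add_zero] at h3
  refine h3.congr' ?_
  filter_upwards [mem_inf_of_right (mem_principal_self _)] with z hzT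
  rw [← add_div, integral_mlInterp_eq_ray ha hb hα (hT z hzT), add_sub_cancel]

lemma tendsto_mlF_div_mlMain_of_four_le {a b α ε : ℝ} (ha : 0 < a) (hb : 0 < b) (hα : 0 < α)
    (h4 : 4 ≤ a * α) :
    Tendsto (fun z => mlF a b α z / mlMain a b α z) (cobounded ℂ ⊓ 𝓟 (mlSector a α ε))
      (𝓝 1) := by
  have hpi := Real.pi_pos
  have harg : ∀ z ∈ mlSector a α ε, arg z = 0 := fun z hz => arg_eq_zero_of_mem_mlSector h4 hz
  have h1 := tendsto_saddle_div_mlMain (b := b) (T := mlSector a α ε)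
    -- Chosen so that wX/a = ⌊|w|x/a⌋ for positive w; the floor moves its argument by at most 1,
    -- hence K = a. Here κ = 1 = cos 0.
    (X := fun w x => a * ⌊‖w‖ / a * x⌋₊ / ‖w‖) (K := a) ha hb hα one_pos
    (fun z hz => by rw [harg z hz]; simpa using hpi)
    (fun z hz => by rw [harg z hz]; simp)
    (fun w => by fun_prop) (fun _ _ _ => by positivity) (fun w x hw hx => by
      have hR : 0 < ‖w‖ := norm_pos_iff.2 hw
      have e : a * ⌊‖w‖ / a * x⌋₊ / ‖w‖ - x = a / ‖w‖ * (⌊‖w‖ / a * x⌋₊ - ‖w‖ / a * x) := by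
        field_simp
      rw [e, abs_mul, abs_of_pos (by positivity)]
      refine mul_le_of_le_one_right (by positivity) ?_
      rw [abs_le]
      have h2 := Nat.floor_le (show 0 ≤ ‖w‖ / a * x by positivity)
      have h3 := Nat.lt_floor_add_one (‖w‖ / a * x)
      constructor <;> linarith)
  refine h1.congr' ?_
  filter_upwards [mem_inf_of_left (eventually_ne_cobounded 0),
    mem_inf_of_right (mem_principal_self _)] with z hz hzT
  congr 1
  have hw : rootExp (a * α) z = (‖rootExp (a * α) z‖ : ℝ) := by
    conv_lhs => rw [rootExp_eq, harg z hzT]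
    simp
  have hR : 0 < ‖rootExp (a * α) z‖ := norm_pos_iff.2 (rootExp_ne_zero _ _)
  have hsub := MeasureTheory.integral_comp_mul_left_Ioi
    (fun y : ℝ => mlInterp a b α z (⌊y⌋₊ : ℕ)) 0 (div_pos hR ha)
  rw [mul_zero] at hsub
  rw [mlF_eq_tsum_mlInterp ha hb hz, tsum_eq_integral_floor (summable_mlInterp ha hb hα z)]
  have ha' : (a : ℂ) ≠ 0 := by exact_mod_cast ha.ne'
  have hRc : ((‖rootExp (a * α) z‖ : ℝ) : ℂ) ≠ 0 := by exact_mod_cast hR.ne'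
  have e : ∀ x : ℝ, rootExp (a * α) z *
      ((a * ⌊‖rootExp (a * α) z‖ / a * x⌋₊ / ‖rootExp (a * α) z‖ : ℝ) : ℂ) / a =
      (⌊‖rootExp (a * α) z‖ / a * x⌋₊ : ℕ) := fun x => by
    conv_lhs => enter [1, 1]; rw [hw]
    push_cast
    field_simp
  simp only [e]
  rw [hsub, real_smul]
  conv_lhs => enter [1, 1]; rw [hw]
  push_cast
  field_simp

end MittagLeffler

theorem mainTheorem1 (a b α ε : ℝ) (ha : 0 < a) (hb : 0 < b) (hα : 0 < α) (hε : 0 < ε) :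
    (∀ z : ℂ, Summable (mlTerm a b α z)) ∧
      IsEquivalent (Bornology.cobounded ℂ ⊓ 𝓟 (mlSector a α ε))
        (mlF a b α) (mlMain a b α) := by
  refine ⟨MittagLeffler.summable_mlTerm ha hb hα, ?_⟩
  refine (isEquivalent_iff_tendsto_one ?_).2 ?_
  · filter_upwards [mem_inf_of_left (Bornology.eventually_ne_cobounded 0)] with z hz
    exact MittagLeffler.mlMain_ne_zero ha b hα hz
  · rcases lt_or_ge (a * α) 4 with h4 | h4
    · exact MittagLeffler.tendsto_mlF_div_mlMain_of_lt_four ha hb hα hε h4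
    · exact MittagLeffler.tendsto_mlF_div_mlMain_of_four_le ha hb hα h4
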